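/- **Theorem 4 (Euler cocycle).** *Quasi-braids.* For $n\ge 1$ let $J_n$ be the group generated by $\alpha_T$, for the intervals $T\subseteq\{1,\dots,n\}$ with at least two letters, with the relations $\alpha_T^2=1$; $\alpha_T\alpha_{T'}=\alpha_{j_T(T')}\alpha_T$ if $T'\subseteq T$; $\alpha_T\alpha_{T'}=\alpha_{T'}\alpha_T$ if $T\cap T'=\emptyset$. Here $j_T$ is the order-reversing bijection of $T$; let $\omega_T\in\Sigma_n$ be the involution that is $j_T$ on $T$ and fixes the other letters. Let $\phi:J_n\to\Sigma_n$, $\alpha_T\mapsto\omega_T$, let $PJ_n=\ker\phi$, and let $\ell_n:J_n\to\mathbb Z/2\mathbb Z$ be the homomorphism with $\ell_n(\alpha_T)=1+|T|$ mod $2$, where $|T|$ is the number of letters of $T$. The simple expansions $\exp_i:J_n\to J_{n+1}$ ($1\le i\le n$) are the maps determined by $\exp_i(\sigma\rho)=\exp_{\phi(\rho)(i)}(\sigma)\exp_i(\rho)$ and, for $T=\{a,\dots,b\}$: $\exp_i(\alpha_T)=\alpha_{\{a,\dots,b+1\}}\alpha_{\{i,i+1\}}$ if $a\le i\le b$; $\exp_i(\alpha_T)=\alpha_{\{a+1,\dots,b+1\}}$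 if $i<a$; $\exp_i(\alpha_T)=\alpha_T$ if $i>b$. *The groups.* Let $\mathbf T$ be the infinite rooted planar dyadic tree. For a finite dyadic planar tree $\alpha$ with $n$ leaves (with the same root as $\mathbf T$), let $\mathbf T^\alpha_1,\dots,\mathbf T^\alpha_n$ be the subtrees of $\mathbf T$ hanging from the leaves of $\alpha$, from left to right. Neretin's group $N$ consists of the bijections of the set of ends of $\mathbf T$ which are given by a symbol $(\alpha_1,\alpha_0,q_\sigma)$: trees $\alpha_0,\alpha_1$ with the same number $n$ of leaves, $\sigma\in\Sigma_n$, and tree isomorphisms $q_i:\mathbf T^{\alpha_0}_i\to\mathbf T^{\alpha_1}_{\sigma(i)}$. The group $\tilde{\mathcal A}_N$ consists of the classes of symbols $(\alpha_1,\alpha_0,q_\sigma)$ with $\sigma\in J_n$ and tree isomorphisms $q_i:\mathbf T^{\alpha_0}_i\to\mathbf T^{\alpha_1}_{\phi(\sigma)(i)}$, for the equivalence relation generated by simple expansions: two edges are attached to the $i$-th leaf of $\alpha_0$ and to the $\phi(\sigma)(i)$-th leaf of $\alpha_1$, $q_i$ is replaced by its restrictions to the two halves, and $\sigma$ is replaced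 by $\exp_i(\sigma)$ if $q_i$ preserves the left-right order of the two halves, and by $\exp_i(\sigma)\alpha_{\{i,i+1\}}$ if $q_i$ exchanges them. Two classes are multiplied by representing them by symbols $(\alpha_2,\alpha_1,r_\tau)$, $(\alpha_1,\alpha_0,q_\sigma)$ and composing the tree isomorphisms and the quasi-braids ($\tau\sigma$). Forgetting the quasi-braid gives a surjective homomorphism $\tilde{\mathcal A}_N\to N$. Let $T_{2^k}$ be the dyadic tree whose $2^k$ leaves all have depth $k$. The kernel $PJ_{2^\infty}$ of $\tilde{\mathcal A}_N\to N$ consists of the classes of the symbols $(T_{2^k},T_{2^k},p)$ with $p\in PJ_{2^k}$ and planar tree isomorphisms, and $\ell_\infty:PJ_{2^\infty}\to\mathbb Z/2\mathbb Z$, $[(T_{2^k},T_{2^k},p)]\mapsto\ell_{2^k}(p)$, is a well-defined surjective homomorphism whose kernel is normal in $\tilde{\mathcal A}_N$. Put $\mathcal A_N=\tilde{\mathcal A}_N/\mathrm{Ker}\,\ell_\infty$. Then $$1\to\mathbb Z/2\mathbb Z\cong PJ_{2^\infty}/\mathrm{Ker}\,\ell_\infty\to\mathcal A_N\to N\to1$$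 is a central extension; let $Eu\in H^2(N,\mathbb Z/2\mathbb Z)$ be its class. *The lengths.* Let $\mathcal R=(\mathbb Z/2\mathbb Z)^{\mathbb N}/(\mathbb Z/2\mathbb Z)^{(\mathbb N)}$ be the ring of $\mathbb Z/2\mathbb Z$-valued sequences modulo almost zero sequences (with trivial $N$-action), and let $j:\mathbb Z/2\mathbb Z\to\mathcal R$ be the embedding by constant sequences. For $\tilde f\in\tilde{\mathcal A}_N$ represented by a symbol with source tree $T_{2^n}$, and for $k\ge n$, let $\sigma_k\in J_{2^k}$ be the quasi-braid of its expansion with source tree $T_{2^k}$. The sequence $(\ell_{2^k}(\sigma_k))_{k\ge n}$ defines an element $\tilde\ell(\tilde f)\in\mathcal R$, and $\tilde\ell$ induces a well-defined map $\ell:\mathcal A_N\to\mathcal R$. *Statement.* For $f,g\in N$ let $$c(f,g)=\ell(\bar f\bar g)-\ell(\bar f)-\ell(\bar g)\in\mathcal R,$$ where $\bar f,\bar g\in\mathcal A_N$ are any lifts of $f$ and $g$. Then $c(f,g)$ does not depend on the choice of the lifts, $c:N\times N\to\mathcal R$ is a 2-cocycle, and its cohomology class in $H^2(N,\mathcal R)$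 is $j_*Eu$. -/

import Mathlib

namespace NeretinEuler

/-! ### Quasi-braid groups -/

/-- Index set of the generators of `J n`: the pair `(a, b)` with `a < b < n` stands for the
connected set of Coxeter generators `T = {σ_a, …, σ_{b-1}}` of the symmetric group on the
letters `0, …, n-1` (with `σ_i = (i, i+1)`); `T` moves exactly the letters `a, …, b`. -/
abbrev QGen (n : ℕ) : Type := {p : ℕ × ℕ // p.1 < p.2 ∧ p.2 < n}

/-- The defining relations of the quasi-braid group: `α_T ^ 2 = 1`;
`α_T α_{T'} = α_{j_T T'} α_T` if `T' ⊆ T`, where `j_T` reverses the interval `T`;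
`α_T α_{T'} = α_{T'} α_T` if `T ∪ T'` is disconnected in the Coxeter graph, i.e. if
the sets of letters moved by `T` and `T'` are disjoint. -/
inductive QRel (n : ℕ) : FreeGroup (QGen n) → Prop
  | sq (t : QGen n) : QRel n (FreeGroup.of t * FreeGroup.of t)
  | nest (t s u : QGen n) (h1 : t.1.1 ≤ s.1.1) (h2 : s.1.2 ≤ t.1.2)
      (hu1 : u.1.1 = t.1.1 + t.1.2 - s.1.2) (hu2 : u.1.2 = t.1.1 + t.1.2 - s.1.1) :
      QRel n (FreeGroup.of t * FreeGroup.of s * (FreeGroup.of u * FreeGroup.of t)⁻¹)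
  | comm (t s : QGen n) (h : t.1.2 < s.1.1) :
      QRel n (FreeGroup.of t * FreeGroup.of s * (FreeGroup.of s * FreeGroup.of t)⁻¹)

/-- The quasi-braid group `J_n`. -/
abbrev J (n : ℕ) : Type := PresentedGroup {r | QRel n r}

/-- The generator `α_T` for the interval `T` of letters `a, …, b`
(with the convention that it is `1` unless `a < b < n`). -/
def al (n a b : ℕ) : J n :=
  if h : a < b ∧ b < n then PresentedGroup.of (⟨(a, b), h⟩ : QGen n) else 1

theorem of_eq_al {n : ℕ} (t : QGen n) :
    (PresentedGroup.of t : J n) = al n t.1.1 t.1.2 := by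
  obtain ⟨⟨a, b⟩, h⟩ := t
  simp only [al]
  rw [dif_pos h]

theorem al_sq (n a b : ℕ) : al n a b * al n a b = 1 := by
  unfold al
  split_ifs with h
  · exact PresentedGroup.one_of_mem (rels := {r | QRel n r}) (QRel.sq ⟨(a, b), h⟩)
  · simp

theorem al_nest {n a b c d e f : ℕ} (hab : a < b) (hb : b < n) (h1 : a ≤ c) (h2 : d ≤ b)
    (he : e + d = a + b) (hf : f + c = a + b) :
    al n a b * al n c d = al n e f * al n a b := by
  by_cases hcd : c < d
  · have h3 : al n c d = PresentedGroup.of (⟨(c, d), hcd, by omega⟩ : QGen n) := by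
      unfold al; rw [dif_pos ⟨by omega, by omega⟩]
    have h4 : al n e f = PresentedGroup.of (⟨(e, f), by omega, by omega⟩ : QGen n) := by
      unfold al; rw [dif_pos ⟨by omega, by omega⟩]
    have h5 : al n a b = PresentedGroup.of (⟨(a, b), hab, hb⟩ : QGen n) := by
      unfold al; rw [dif_pos ⟨by omega, by omega⟩]
    have := PresentedGroup.one_of_mem (rels := {r | QRel n r})
      (QRel.nest ⟨(a, b), hab, hb⟩ ⟨(c, d), hcd, by omega⟩ ⟨(e, f), by omega, by omega⟩ h1 h2
        (by simp only; omega) (by simp only; omega))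
    rw [h3, h4, h5]
    rw [map_mul, map_inv, mul_inv_eq_one] at this
    exact this
  · have h3 : al n c d = 1 := by unfold al; rw [dif_neg]; omega
    have h4 : al n e f = 1 := by unfold al; rw [dif_neg]; omega
    rw [h3, h4]; simp

theorem al_comm {n a b c d : ℕ} (h : b < c) :
    al n a b * al n c d = al n c d * al n a b := by
  unfold al
  split_ifs with h1 h2 h3
  · have := PresentedGroup.one_of_mem (rels := {r | QRel n r})
      (QRel.comm ⟨(a, b), h1⟩ ⟨(c, d), h2⟩ h)
    rw [map_mul, map_inv, mul_inv_eq_one] at this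
    exact this
  all_goals simp

theorem J_induction {n : ℕ} (P : J n → Prop) (h1 : P 1)
    (hm : ∀ a b, a < b → b < n → ∀ y, P y → P (al n a b * y)) (x : J n) : P x := by
  have hx : x ∈ Subgroup.closure (Set.range (PresentedGroup.of (rels := {r | QRel n r}))) := by
    rw [PresentedGroup.closure_range_of]; trivial
  induction hx using Subgroup.closure_induction_left with
  | one => exact h1
  | mul_left x hx y _ ih =>
    obtain ⟨t, rfl⟩ := hx
    rw [of_eq_al]
    exact hm _ _ t.2.1 t.2.2 _ ih
  | inv_mul_cancel x hx y _ ih =>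
    obtain ⟨t, rfl⟩ := hx
    rw [of_eq_al, inv_eq_of_mul_eq_one_left (al_sq _ _ _)]
    exact hm _ _ t.2.1 t.2.2 _ ih

/-- To define a homomorphism on `J n` it suffices to check the three families of relations. -/
def Jlift {n : ℕ} {G : Type*} [Group G] (F : ℕ → ℕ → G)
    (hsq : ∀ a b, a < b → b < n → F a b * F a b = 1)
    (hnest : ∀ a b c d e f, a < b → b < n → c < d → a ≤ c → d ≤ b → e + d = a + b →
      f + c = a + b → F a b * F c d = F e f * F a b)
    (hcomm : ∀ a b c d, a < b → b < c → c < d → d < n → F a b * F c d = F c d * F a b) :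
    J n →* G :=
  PresentedGroup.toGroup (rels := {r | QRel n r}) (f := fun t => F t.1.1 t.1.2) (by
    intro r hr
    induction hr with
    | sq t => simpa using hsq _ _ t.2.1 t.2.2
    | nest t s u h1 h2 hu1 hu2 =>
      have := t.2; have := s.2; have := u.2
      simp only [map_mul, map_inv, FreeGroup.lift_apply_of]
      rw [mul_inv_eq_one]
      exact hnest _ _ _ _ _ _ t.2.1 t.2.2 s.2.1 h1 h2 (by omega) (by omega)
    | comm t s h =>
      simp only [map_mul, map_inv, FreeGroup.lift_apply_of]
      rw [mul_inv_eq_one]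
      exact hcomm _ _ _ _ t.2.1 h s.2.1 s.2.2)

theorem Jlift_al {n : ℕ} {G : Type*} [Group G] (F : ℕ → ℕ → G) (hsq) (hnest) (hcomm)
    {a b : ℕ} (h1 : a < b) (h2 : b < n) :
    Jlift (n := n) F hsq hnest hcomm (al n a b) = F a b := by
  unfold al Jlift
  rw [dif_pos ⟨h1, h2⟩]
  exact PresentedGroup.toGroup.of _

/-- The function reversing the interval `a, …, b` and fixing the other letters. -/
def revFun (a b i : ℕ) : ℕ := if a ≤ i ∧ i ≤ b then a + b - i else i

theorem revFun_invol (a b : ℕ) : Function.Involutive (revFun a b) := by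
  intro i; unfold revFun; split_ifs <;> omega

/-- The involution `ω_T`, reversing the interval of letters `a, …, b`. -/
def rev (a b : ℕ) : Equiv.Perm ℕ := (revFun_invol a b).toPerm

theorem rev_apply (a b i : ℕ) : rev a b i = if a ≤ i ∧ i ≤ b then a + b - i else i := rfl

/-- The homomorphism `φ : J_n → Σ_n`, `α_T ↦ ω_T`; the symmetric group `Σ_n` is realized as the
group of permutations of `ℕ` moving only letters `< n`. -/
def toPerm (n : ℕ) : J n →* Equiv.Perm ℕ :=
  Jlift rev
    (by intro a b _ _; ext i; simp only [Equiv.Perm.mul_apply, rev_apply, Equiv.Perm.one_apply]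
        split_ifs <;> omega)
    (by intro a b c d e f _ _ _ _ _ _ _; ext i; simp only [Equiv.Perm.mul_apply, rev_apply]
        split_ifs <;> omega)
    (by intro a b c d _ _ _ _; ext i; simp only [Equiv.Perm.mul_apply, rev_apply]
        split_ifs <;> omega)

theorem toPerm_al {n a b : ℕ} (h1 : a < b) (h2 : b < n) : toPerm n (al n a b) = rev a b :=
  Jlift_al _ _ _ _ h1 h2

/-- The pure quasi-braid group `PJ_n`. -/
def PJ (n : ℕ) : Subgroup (J n) := (toPerm n).ker

/-- The length modulo two: `α_T ↦ 1 + |T|`, where `|T|` is the number of letters of `T`. -/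
def len (n : ℕ) : J n →* Multiplicative (ZMod 2) :=
  Jlift (fun a b => Multiplicative.ofAdd (1 + ((b - a + 1 : ℕ) : ZMod 2)))
    (by
      intro a b _ _
      rw [← ofAdd_add, CharTwo.add_self_eq_zero]; rfl)
    (by
      intro a b c d e f _ _ _ _ _ _ _
      have : f - e = d - c := by omega
      rw [this, mul_comm])
    (by intros; rw [mul_comm])

theorem len_al {n a b : ℕ} (h1 : a < b) (h2 : b < n) :
    len n (al n a b) = Multiplicative.ofAdd (1 + ((b - a + 1 : ℕ) : ZMod 2)) :=
  Jlift_al _ _ _ _ h1 h2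

/-! ### Simple expansions of quasi-braids -/

/-- The elementary quasi-braid transposition `α_{(i, i+1)}`. -/
def tau (n i : ℕ) : J n := al n i (i + 1)

/-- Simple expansion of a generator at the letter `i`: the letters `> i` are shifted by one, and if
`i` belongs to the support of `T`, then `α_{(a, …, b)}` becomes
`α_{(a, …, b + 1)} α_{(i, i + 1)}`. -/
def expGen (n a b i : ℕ) : J (n + 1) :=
  if i < a then al (n + 1) (a + 1) (b + 1)
  else if b < i then al (n + 1) a b
  else al (n + 1) a (b + 1) * tau (n + 1) i

theorem expGen_invol {n a b : ℕ} (h1 : a < b) (h2 : b < n) (i : ℕ) :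
    expGen n a b (rev a b i) * expGen n a b i = 1 := by
  rw [rev_apply]
  by_cases hi : a ≤ i ∧ i ≤ b
  · rw [if_pos hi]
    unfold expGen
    rw [if_neg (by omega), if_neg (by omega), if_neg (by omega), if_neg (by omega)]
    unfold tau
    rw [mul_assoc, ← mul_assoc (al (n+1) (a + b - i) _),
      ← al_nest (a := a) (b := b + 1) (c := i) (d := i + 1) (by omega) (by omega) (by omega)
        (by omega) (by omega) (by omega), mul_assoc, al_sq, mul_one, al_sq]
  · rw [if_neg hi]
    unfold expGen
    split_ifs
    · exact al_sq _ _ _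
    · exact al_sq _ _ _
    · omega

/-- The permutation `(x, i) ↦ (exp_i(α_T) x, ω_T(i))`. -/
def expStep (n a b : ℕ) (h1 : a < b) (h2 : b < n) : Equiv.Perm (J (n + 1) × ℕ) :=
  Function.Involutive.toPerm (fun p => (expGen n a b p.2 * p.1, rev a b p.2)) (by
    rintro ⟨x, i⟩
    simp only [← mul_assoc, expGen_invol h1 h2, one_mul]
    congr 1
    exact revFun_invol a b i)

theorem expStep_apply {n a b : ℕ} (h1 : a < b) (h2 : b < n) (x : J (n + 1)) (i : ℕ) :
    expStep n a b h1 h2 (x, i) = (expGen n a b i * x, rev a b i) := rfl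

theorem expGen_lt {n a b i : ℕ} (h : i < a) : expGen n a b i = al (n + 1) (a + 1) (b + 1) := by
  unfold expGen; rw [if_pos h]

theorem expGen_gt {n a b i : ℕ} (h1 : a ≤ b) (h : b < i) :
    expGen n a b i = al (n + 1) a b := by
  unfold expGen; rw [if_neg (by omega), if_pos h]

theorem expGen_mem {n a b i : ℕ} (h1 : a ≤ i) (h : i ≤ b) :
    expGen n a b i = al (n + 1) a (b + 1) * tau (n + 1) i := by
  unfold expGen; rw [if_neg (by omega), if_neg (by omega)]

theorem al_tau {n a b i k : ℕ} (hb : b + 1 < n) (h1 : a ≤ i) (h2 : i ≤ b) (hk : k + i = a + b) :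
    al n a (b + 1) * tau n i = tau n k * al n a (b + 1) := by
  unfold tau
  exact al_nest (by omega) (by omega) (by omega) (by omega) (by omega) (by omega)

theorem tau_sq (n i : ℕ) : tau n i * tau n i = 1 := al_sq _ _ _

theorem expGen_nest {n a b c d e f : ℕ} (hab : a < b) (hb : b < n) (hcd : c < d) (h1 : a ≤ c)
    (h2 : d ≤ b) (he : e + d = a + b) (hf : f + c = a + b) (i : ℕ) :
    expGen n a b (rev c d i) * expGen n c d i = expGen n e f (rev a b i) * expGen n a b i := by
  rw [rev_apply, rev_apply]
  by_cases hi : a ≤ i ∧ i ≤ b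
  · rw [if_pos hi]
    by_cases hi' : c ≤ i ∧ i ≤ d
    · rw [if_pos hi', expGen_mem (i := c + d - i) (by omega) (by omega),
        expGen_mem (a := c) (by omega) (by omega), expGen_mem (a := e) (by omega) (by omega),
        expGen_mem (a := a) (i := i) (by omega) (by omega),
        al_tau (a := c) (k := c + d - i) (by omega) (by omega) (by omega) (by omega),
        al_tau (a := a) (i := i) (k := a + b - i) (by omega) (by omega) (by omega) (by omega)]
      rw [mul_assoc, ← mul_assoc (tau _ _), tau_sq, one_mul, mul_assoc, ← mul_assoc (tau _ _),
        tau_sq, one_mul]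
      exact al_nest (by omega) (by omega) (by omega) (by omega) (by omega) (by omega)
    · rw [if_neg hi', expGen_mem (a := a) (i := i) (by omega) (by omega)]
      by_cases hlt : i < c
      · rw [expGen_lt (a := c) (by omega), expGen_gt (a := e) (by omega) (by omega), mul_assoc,
          tau, al_comm (by omega), ← mul_assoc, ← mul_assoc]
        congr 1
        exact al_nest (by omega) (by omega) (by omega) (by omega) (by omega) (by omega)
      · rw [expGen_gt (a := c) (by omega) (by omega), expGen_lt (a := e) (by omega), mul_assoc,
          tau, ← al_comm (by omega), ← mul_assoc, ← mul_assoc]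
        congr 1
        exact al_nest (by omega) (by omega) (by omega) (by omega) (by omega) (by omega)
  · rw [if_neg hi, if_neg (by omega)]
    by_cases hlt : i < a
    · rw [expGen_lt (by omega), expGen_lt (by omega), expGen_lt (by omega)]
      exact al_nest (by omega) (by omega) (by omega) (by omega) (by omega) (by omega)
    · rw [expGen_gt (by omega) (by omega), expGen_gt (by omega) (by omega),
        expGen_gt (by omega) (by omega)]
      exact al_nest (by omega) (by omega) (by omega) (by omega) (by omega) (by omega)

theorem expGen_comm {n a b c d : ℕ} (hab : a < b) (hbc : b < c) (hcd : c < d) (i : ℕ) :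
    expGen n a b (rev c d i) * expGen n c d i = expGen n c d (rev a b i) * expGen n a b i := by
  rw [rev_apply, rev_apply]
  by_cases hi : a ≤ i ∧ i ≤ b
  · rw [if_pos hi, if_neg (by omega), expGen_mem (a := a) (by omega) (by omega),
      expGen_lt (by omega), expGen_lt (by omega), tau, mul_assoc,
      al_comm (by omega), ← mul_assoc, al_comm (by omega), mul_assoc]
  · rw [if_neg hi]
    by_cases hi' : c ≤ i ∧ i ≤ d
    · rw [if_pos hi', expGen_mem (a := c) (by omega) (by omega),
        expGen_gt (by omega) (by omega), expGen_gt (by omega) (by omega), tau, mul_assoc,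
        ← al_comm (a := a) (b := b) (c := i) (by omega), ← mul_assoc, ← mul_assoc,
        al_comm (c := c) (by omega)]
    · rw [if_neg hi']
      unfold expGen tau
      split_ifs <;> first | omega | exact al_comm (by omega)

/-- The action of `J n` which encodes all the simple expansions:
`(x, i) ↦ (exp_i(σ) x, φ(σ)(i))`. -/
def expAct (n : ℕ) : J n →* Equiv.Perm (J (n + 1) × ℕ) :=
  Jlift (fun a b => if h : a < b ∧ b < n then expStep n a b h.1 h.2 else 1)
    (by
      intro a b h1 h2
      ext1 ⟨x, i⟩
      rw [dif_pos ⟨h1, h2⟩]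
      exact (Function.Involutive.toPerm_involutive _ (x, i)))
    (by
      intro a b c d e f h1 h2 h3 h4 h5 h6 h7
      ext1 ⟨x, i⟩
      rw [dif_pos ⟨h1, h2⟩, dif_pos ⟨h3, by omega⟩, dif_pos ⟨by omega, by omega⟩]
      simp only [Equiv.Perm.mul_apply, expStep_apply, ← mul_assoc,
        expGen_nest h1 h2 h3 h4 h5 h6 h7]
      congr 1
      simp only [rev_apply]
      split_ifs <;> omega)
    (by
      intro a b c d h1 h2 h3 h4
      ext1 ⟨x, i⟩
      rw [dif_pos ⟨h1, by omega⟩, dif_pos ⟨h3, h4⟩]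
      simp only [Equiv.Perm.mul_apply, expStep_apply, ← mul_assoc, expGen_comm h1 h2 h3]
      congr 1
      simp only [rev_apply]
      split_ifs <;> omega)

/-- The simple expansion map `exp_i : J_n → J_{n+1}`, expanding the letter `i`.  It is the unique
map with `exp_i(α_T)` as in `expGen` and `exp_i(σ ρ) = exp_{ρ(i)}(σ) exp_i(ρ)`. -/
def expand {n : ℕ} (i : ℕ) (σ : J n) : J (n + 1) := (expAct n σ (1, i)).1

theorem expAct_al {n a b : ℕ} (h1 : a < b) (h2 : b < n) (x : J (n + 1)) (i : ℕ) :
    expAct n (al n a b) (x, i) = (expGen n a b i * x, rev a b i) := by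
  unfold expAct
  rw [Jlift_al _ _ _ _ h1 h2, dif_pos ⟨h1, h2⟩, expStep_apply]

theorem expAct_apply {n : ℕ} (σ : J n) (x : J (n + 1)) (i : ℕ) :
    expAct n σ (x, i) = (expand i σ * x, toPerm n σ i) := by
  unfold expand
  induction σ using J_induction generalizing x i with
  | h1 => simp
  | hm a b h1 h2 y ih =>
    simp only [map_mul, Equiv.Perm.mul_apply]
    rw [ih x i, ih 1 i, expAct_al h1 h2, expAct_al h1 h2, toPerm_al h1 h2]
    simp [mul_assoc]

theorem expand_al {n a b : ℕ} (h1 : a < b) (h2 : b < n) (i : ℕ) :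
    expand i (al n a b) = expGen n a b i := by
  unfold expand; rw [expAct_al h1 h2]; simp

theorem expand_one {n : ℕ} (i : ℕ) : expand i (1 : J n) = 1 := by
  unfold expand; simp

theorem expand_mul {n : ℕ} (i : ℕ) (σ ρ : J n) :
    expand i (σ * ρ) = expand (toPerm n ρ i) σ * expand i ρ := by
  have h := expAct_apply (σ * ρ) 1 i
  rw [map_mul, Equiv.Perm.mul_apply, expAct_apply, expAct_apply] at h
  simpa using (congrArg Prod.fst h).symm

theorem expand_inv {n : ℕ} (i : ℕ) (σ : J n) :
    expand (toPerm n σ i) σ⁻¹ = (expand i σ)⁻¹ := by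
  have h := expand_mul i σ⁻¹ σ
  rw [inv_mul_cancel, expand_one] at h
  exact eq_inv_of_mul_eq_one_left h.symm

/-- New position of the letter `k` after the expansion of the letter `i`. -/
def up (i k : ℕ) : ℕ := if k ≤ i then k else k + 1

theorem toPerm_expGen {n a b : ℕ} (h1 : a < b) (h2 : b < n) (i k : ℕ) :
    toPerm (n + 1) (expGen n a b i) (up i k) = up (rev a b i) (rev a b k) ∧
      toPerm (n + 1) (expGen n a b i) (i + 1) = rev a b i + 1 := by
  unfold expGen tau
  split_ifs with h3 h4
  · rw [toPerm_al (by omega) (by omega)]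
    simp only [rev_apply, up]
    constructor <;> split_ifs <;> omega
  · rw [toPerm_al (by omega) (by omega)]
    simp only [rev_apply, up]
    constructor <;> split_ifs <;> omega
  · rw [map_mul, Equiv.Perm.mul_apply, Equiv.Perm.mul_apply, toPerm_al (by omega) (by omega),
      toPerm_al (by omega) (by omega)]
    have hr : rev a b i = a + b - i := by rw [rev_apply, if_pos (by omega)]
    have ht : ∀ m, rev i (i + 1) m = if m = i then i + 1 else if m = i + 1 then i else m := by
      intro m; rw [rev_apply]; split_ifs <;> omega
    constructor
    · rw [hr, ht]
      rcases lt_trichotomy k i with h | h | h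
      · have : up i k = k := by unfold up; rw [if_pos (by omega)]
        rw [this, if_neg (by omega), if_neg (by omega), rev_apply, rev_apply]
        unfold up
        split_ifs <;> omega
      · subst h
        have : up k k = k := by unfold up; rw [if_pos (by omega)]
        rw [this, if_pos rfl, rev_apply, rev_apply]
        unfold up
        split_ifs <;> omega
      · have : up i k = k + 1 := by unfold up; rw [if_neg (by omega)]
        rw [this, if_neg (by omega), if_neg (by omega), rev_apply, rev_apply]
        unfold up
        split_ifs <;> omega
    · rw [hr, ht, if_neg (by omega), if_pos rfl, rev_apply]
      split_ifs <;> omega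

theorem toPerm_expand {n : ℕ} (σ : J n) (i k : ℕ) :
    toPerm (n + 1) (expand i σ) (up i k) = up (toPerm n σ i) (toPerm n σ k) ∧
      toPerm (n + 1) (expand i σ) (i + 1) = toPerm n σ i + 1 := by
  induction σ using J_induction with
  | h1 => simp [expand_one]
  | hm a b h1 h2 y ih =>
    rw [expand_mul, expand_al h1 h2, map_mul, map_mul, toPerm_al h1 h2]
    simp only [Equiv.Perm.mul_apply]
    rw [ih.1, ih.2]
    exact toPerm_expGen h1 h2 _ _

theorem toPerm_lt {n : ℕ} (σ : J n) (i : ℕ) : toPerm n σ i < n ↔ i < n := by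
  induction σ using J_induction with
  | h1 => simp
  | hm a b h1 h2 y ih =>
    rw [map_mul, Equiv.Perm.mul_apply, toPerm_al h1 h2, rev_apply, ← ih]
    split_ifs <;> omega

theorem tau_mul_expand {n : ℕ} (σ : J n) (i : ℕ) :
    tau (n + 1) (toPerm n σ i) * expand i σ = expand i σ * tau (n + 1) i := by
  induction σ using J_induction with
  | h1 => simp [expand_one]
  | hm a b h1 h2 y ih =>
    rw [expand_mul, expand_al h1 h2, map_mul, toPerm_al h1 h2, mul_assoc, ← ih, ← mul_assoc,
      ← mul_assoc, Equiv.Perm.mul_apply]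
    congr 1
    generalize toPerm n y i = k
    rw [rev_apply]
    unfold expGen tau
    split_ifs
    · omega
    · omega
    · rw [← mul_assoc, ← al_nest (a := a) (b := b + 1) (c := k) (d := k + 1) (by omega)
        (by omega) (by omega) (by omega) (by omega) (by omega)]
    · exact al_comm (by omega)
    · exact (al_comm (by omega)).symm
    · omega

theorem len_tau {n i : ℕ} (h : i + 1 < n) : len n (tau n i) = Multiplicative.ofAdd 1 := by
  unfold tau
  rw [len_al (by omega) h]
  congr 1
  have : i + 1 - i + 1 = 2 := by omega
  rw [this]; decide

theorem len_expand {n : ℕ} (σ : J n) (i : ℕ) : len (n + 1) (expand i σ) = len n σ := by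
  induction σ using J_induction with
  | h1 => simp [expand_one]
  | hm a b h1 h2 y ih =>
    rw [expand_mul, map_mul, map_mul, ih, expand_al h1 h2]
    congr 1
    generalize toPerm n y i = k
    unfold expGen
    rw [len_al h1 h2]
    split_ifs
    · rw [len_al (by omega) (by omega)]
      congr 3; omega
    · rw [len_al (by omega) (by omega)]
    · rw [map_mul, len_tau (by omega), len_al (by omega) (by omega), ← ofAdd_add]
      congr 1
      have : b + 1 - a + 1 = (b - a + 1) + 1 := by omega
      rw [this, Nat.cast_add _ 1]
      generalize ((b - a + 1 : ℕ) : ZMod 2) = z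
      revert z; decide

theorem expand_tau {n i j : ℕ} (hj : j + 1 < n) (h : i ≠ j) (h' : i ≠ j + 1) :
    expand i (tau n j) = tau (n + 1) (up i j) := by
  unfold tau
  rw [expand_al (by omega) hj]
  unfold expGen up
  split_ifs <;> first | rfl | omega

theorem tau_comm {n i j : ℕ} (h : i + 1 < j) : tau n i * tau n j = tau n j * tau n i :=
  al_comm h

theorem toPerm_tau {n i : ℕ} (h : i + 1 < n) : toPerm n (tau n i) = rev i (i + 1) :=
  toPerm_al (by omega) h

theorem expGen_expand {n a b i j : ℕ} (h1 : a < b) (h2 : b < n) (hij : i < j) :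
    expand (j + 1) (expGen n a b i) = expand i (expGen n a b j) := by
  rcases lt_or_ge i a with hi | hi
  · rw [expGen_lt hi, expand_al (by omega) (by omega)]
    rcases lt_or_ge j a with hj | hj
    · rw [expGen_lt hj, expand_al (by omega) (by omega), expGen_lt (by omega),
        expGen_lt (by omega)]
    · rcases lt_or_ge b j with hj' | hj'
      · rw [expGen_gt h1.le hj', expand_al (by omega) (by omega), expGen_gt (by omega) (by omega),
          expGen_lt (by omega)]
      · rw [expGen_mem hj hj', expand_mul, toPerm_tau (by omega), rev_apply,
          if_neg (by omega), expand_al (by omega) (by omega), expand_tau (by omega)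
          (by omega) (by omega), expGen_lt (i := i) (by omega),
          expGen_mem (i := j + 1) (by omega) (by omega), up,
          if_neg (by omega)]
  · rcases lt_or_ge b i with hi' | hi'
    · rw [expGen_gt h1.le hi', expGen_gt h1.le (by omega), expand_al (by omega) (by omega),
        expand_al (by omega) (by omega), expGen_gt h1.le (by omega), expGen_gt h1.le (by omega)]
    · rw [expGen_mem hi hi', expand_mul, toPerm_tau (by omega), rev_apply,
        if_neg (by omega), expand_al (by omega) (by omega), expand_tau (by omega)
        (by omega) (by omega), up, if_pos (by omega)]
      rcases lt_or_ge b j with hj' | hj'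
      · rw [expGen_gt (a := a) (b := b) (by omega) hj', expand_al (by omega) (by omega),
          expGen_gt (by omega) (by omega), expGen_mem (by omega) (by omega)]
      · rw [expGen_mem (a := a) (b := b) (by omega) hj', expand_mul, toPerm_tau (by omega), rev_apply,
          if_neg (by omega), expand_al (by omega) (by omega), expand_tau (by omega)
          (by omega) (by omega), up, if_neg (by omega), expGen_mem (by omega) (by omega),
          expGen_mem (by omega) (by omega), mul_assoc, mul_assoc,
          tau_comm (i := i) (j := j + 1) (by omega)]

theorem expand_expand {n : ℕ} (σ : J n) {i j : ℕ} (hij : i ≠ j) :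
    expand (up i j) (expand i σ) = expand (up j i) (expand j σ) := by
  induction σ using J_induction with
  | h1 => simp [expand_one]
  | hm a b h1 h2 y ih =>
    rw [expand_mul i, expand_mul j, expand_mul, expand_mul, ih, (toPerm_expand y i j).1,
      (toPerm_expand y j i).1, expand_al h1 h2, expand_al h1 h2]
    congr 1
    have hne : toPerm n y i ≠ toPerm n y j := fun h => hij ((toPerm n y).injective h)
    revert hne
    generalize toPerm n y i = k
    generalize toPerm n y j = l
    intro hne
    unfold up
    rcases lt_or_gt_of_ne hne with h | h
    · rw [if_neg (by omega), if_pos (by omega)]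
      exact expGen_expand h1 h2 h
    · rw [if_pos (by omega), if_neg (by omega)]
      exact (expGen_expand h1 h2 h).symm

/-- Surjectivity of `φ`. -/
theorem toPerm_surj {n : ℕ} (π : Equiv.Perm (Fin n)) :
    ∃ σ : J n, ∀ i : Fin n, toPerm n σ i = π i := by
  obtain _ | n := n
  · exact ⟨1, fun i => i.elim0⟩
  have hπ : π ∈ Submonoid.closure
      (Set.range fun i : Fin n => Equiv.swap i.castSucc i.succ) := by
    rw [Equiv.Perm.mclosure_swap_castSucc_succ]; trivial
  induction hπ using Submonoid.closure_induction with
  | one => exact ⟨1, fun i => by simp⟩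
  | mul x y _ _ hx hy =>
    obtain ⟨s, hs⟩ := hx
    obtain ⟨t, ht⟩ := hy
    exact ⟨s * t, fun i => by rw [map_mul, Equiv.Perm.mul_apply, ht, hs]; rfl⟩
  | mem x hx =>
    obtain ⟨k, rfl⟩ := hx
    refine ⟨tau (n + 1) k, fun i => ?_⟩
    have := k.2
    rw [toPerm_tau (by omega), rev_apply]
    by_cases h1 : i = k.castSucc
    · subst h1; simp
    by_cases h2 : i = k.succ
    · subst h2; simp
    · simp only [Equiv.swap_apply_of_ne_of_ne h1 h2]
      rw [Fin.ext_iff] at h1 h2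
      simp only [Fin.val_castSucc, Fin.val_succ] at h1 h2
      rw [if_neg (by omega)]

/-! ### Dyadic planar trees -/

/-- Finite rooted planar dyadic trees. -/
inductive DTree : Type
  | leaf : DTree
  | node : DTree → DTree → DTree

namespace DTree

/-- The number of leaves. -/
def num : DTree → ℕ
  | leaf => 1
  | node l r => l.num + r.num

/-- The address of the `i`-th leaf (from left to right, starting with `0`): the word describing the
path from the root, `false` meaning left and `true` meaning right. -/
def word : DTree → ℕ → List Bool
  | leaf, _ => []
  | node l r, i => if i < l.num then false :: l.word i else true :: r.word (i - l.num)

/-- The simple expansion: two edges are attached to the `i`-th leaf. -/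
def expand : DTree → ℕ → DTree
  | leaf, _ => node leaf leaf
  | node l r, i => if i < l.num then node (l.expand i) r else node l (r.expand (i - l.num))

/-- The dyadic tree `T_{2^k}`, all of whose `2^k` leaves are at depth `k`. -/
def full : ℕ → DTree
  | 0 => leaf
  | k + 1 => node (full k) (full k)

/-- `t ≤ s`: the tree `s` is an expansion of `t`. -/
def le : DTree → DTree → Prop
  | leaf, _ => True
  | node _ _, leaf => False
  | node l r, node l' r' => le l l' ∧ le r r'

/-- The union of two trees. -/
def sup : DTree → DTree → DTree
  | leaf, t => t
  | node l r, leaf => node l r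
  | node l r, node l' r' => node (sup l l') (sup r r')

theorem num_pos (t : DTree) : 0 < t.num := by
  induction t with
  | leaf => simp [num]
  | node l r ihl ihr => simp only [num]; omega

theorem num_full (k : ℕ) : (full k).num = 2 ^ k := by
  induction k with
  | zero => rfl
  | succ k ih => simp only [full, num, ih]; ring

theorem num_expand {t : DTree} {i : ℕ} (hi : i < t.num) : (t.expand i).num = t.num + 1 := by
  induction t generalizing i with
  | leaf => rfl
  | node l r ihl ihr =>
    simp only [num, expand] at *
    split_ifs with h
    · simp only [num, ihl h]; omega
    · simp only [num, ihr (i := i - l.num) (by omega)]; omega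

theorem word_expand {t : DTree} {i k : ℕ} (hi : i < t.num) (hk : k < t.num) :
    (t.expand i).word (up i k) = if k = i then t.word i ++ [false] else t.word k := by
  induction t generalizing i k with
  | leaf =>
    simp only [num] at hi hk
    obtain rfl : i = 0 := by omega
    obtain rfl : k = 0 := by omega
    rfl
  | node l r ihl ihr =>
    simp only [num] at hi hk
    by_cases h : i < l.num
    · simp only [expand, if_pos h, word, num_expand h]
      by_cases h' : k < l.num
      · have := ihl h h'
        rw [if_pos (by unfold up; split_ifs <;> omega), this]
        split_ifs <;> simp
      · rw [if_neg (by unfold up; split_ifs <;> omega), if_neg (by omega), if_neg h']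
        congr 2
        unfold up; split_ifs <;> omega
    · simp only [expand, if_neg h, word]
      by_cases h' : k < l.num
      · rw [if_pos (by unfold up; split_ifs <;> omega), if_neg (by omega), if_pos h']
        congr 2
        unfold up; split_ifs <;> omega
      · have := ihr (i := i - l.num) (k := k - l.num) (by omega) (by omega)
        rw [if_neg (by unfold up; split_ifs <;> omega), if_neg h']
        have h2 : up i k - l.num = up (i - l.num) (k - l.num) := by
          unfold up; split_ifs <;> omega
        rw [h2, this]
        have h3 : k - l.num = i - l.num ↔ k = i := by omega
        simp only [h3]
        split_ifs <;> simp

theorem word_expand_succ {t : DTree} {i : ℕ} (hi : i < t.num) :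
    (t.expand i).word (i + 1) = t.word i ++ [true] := by
  induction t generalizing i with
  | leaf =>
    simp only [num] at hi
    obtain rfl : i = 0 := by omega
    rfl
  | node l r ihl ihr =>
    simp only [num] at hi
    by_cases h : i < l.num
    · simp only [expand, if_pos h, word, num_expand h]
      rw [if_pos (by omega), ihl h]; simp
    · simp only [expand, if_neg h, word]
      rw [if_neg (by omega), show i + 1 - l.num = (i - l.num) + 1 by omega,
        ihr (by omega)]; simp

theorem expand_comm {t : DTree} {i j : ℕ} (hi : i < t.num) (hj : j < t.num) (hij : i ≠ j) :
    (t.expand i).expand (up i j) = (t.expand j).expand (up j i) := by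
  induction t generalizing i j with
  | leaf => simp only [num] at hi hj; omega
  | node l r ihl ihr =>
    simp only [num] at hi hj
    by_cases h : i < l.num
    · by_cases h' : j < l.num
      · have := ihl h h' hij
        simp only [expand, if_pos h, if_pos h', num_expand h, num_expand h']
        rw [if_pos (by unfold up; split_ifs <;> omega), if_pos (by unfold up; split_ifs <;> omega),
          this]
      · simp only [expand, if_pos h, if_neg h', num_expand h]
        rw [if_neg (by unfold up; split_ifs <;> omega), if_pos (by unfold up; split_ifs <;> omega)]
        congr 2 <;> (unfold up; split_ifs <;> omega)
    · by_cases h' : j < l.num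
      · simp only [expand, if_neg h, if_pos h', num_expand h']
        rw [if_pos (by unfold up; split_ifs <;> omega), if_neg (by unfold up; split_ifs <;> omega)]
        congr 2 <;> (unfold up; split_ifs <;> omega)
      · have := ihr (i := i - l.num) (j := j - l.num) (by omega) (by omega) (by omega)
        simp only [expand, if_neg h, if_neg h']
        rw [if_neg (by unfold up; split_ifs <;> omega), if_neg (by unfold up; split_ifs <;> omega)]
        congr 1
        convert this using 2 <;> (unfold up; split_ifs <;> omega)

theorem le_refl (t : DTree) : le t t := by
  induction t with
  | leaf => trivial
  | node l r ihl ihr => exact ⟨ihl, ihr⟩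

theorem le_trans {t s u : DTree} (h1 : le t s) (h2 : le s u) : le t u := by
  induction t generalizing s u with
  | leaf => trivial
  | node l r ihl ihr =>
    cases s with
    | leaf => exact h1.elim
    | node l' r' =>
      cases u with
      | leaf => exact h2.elim
      | node l'' r'' => exact ⟨ihl h1.1 h2.1, ihr h1.2 h2.2⟩

theorem num_le {t s : DTree} (h : le t s) : t.num ≤ s.num := by
  induction t generalizing s with
  | leaf => exact s.num_pos
  | node l r ihl ihr =>
    cases s with
    | leaf => exact h.elim
    | node l' r' => exact Nat.add_le_add (ihl h.1) (ihr h.2)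

theorem le_sup_left (t s : DTree) : le t (sup t s) := by
  induction t generalizing s with
  | leaf => trivial
  | node l r ihl ihr =>
    cases s with
    | leaf => exact le_refl _
    | node l' r' => exact ⟨ihl _, ihr _⟩

theorem le_sup_right (t s : DTree) : le s (sup t s) := by
  induction t generalizing s with
  | leaf => exact le_refl _
  | node l r ihl ihr =>
    cases s with
    | leaf => trivial
    | node l' r' => exact ⟨ihl _, ihr _⟩

theorem le_expand (t : DTree) (i : ℕ) : le t (t.expand i) := by
  induction t generalizing i with
  | leaf => trivial
  | node l r ihl ihr =>
    simp only [expand]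
    split_ifs
    · exact ⟨ihl _, le_refl _⟩
    · exact ⟨le_refl _, ihr _⟩

theorem le_full (t : DTree) : ∃ K, ∀ k, K ≤ k → le t (full k) := by
  induction t with
  | leaf => exact ⟨0, fun _ _ => trivial⟩
  | node l r ihl ihr =>
    obtain ⟨K, hK⟩ := ihl
    obtain ⟨K', hK'⟩ := ihr
    refine ⟨K + K' + 1, fun k hk => ?_⟩
    obtain ⟨k, rfl⟩ : ∃ m, k = m + 1 := ⟨k - 1, by omega⟩
    exact ⟨hK _ (by omega), hK' _ (by omega)⟩

theorem eq_or_expand_le {t s : DTree} (h : le t s) :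
    t = s ∨ ∃ i < t.num, le (t.expand i) s := by
  induction t generalizing s with
  | leaf =>
    cases s with
    | leaf => exact Or.inl rfl
    | node l r => exact Or.inr ⟨0, by simp [num], trivial, trivial⟩
  | node l r ihl ihr =>
    cases s with
    | leaf => exact h.elim
    | node l' r' =>
      rcases ihl h.1 with h1 | ⟨i, hi, h1⟩
      · rcases ihr h.2 with h2 | ⟨i, hi, h2⟩
        · left; rw [h1, h2]
        · refine Or.inr ⟨l.num + i, by simp only [num]; omega, ?_⟩
          simp only [expand]
          rw [if_neg (by omega), Nat.add_sub_cancel_left]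
          exact ⟨h.1, h2⟩
      · refine Or.inr ⟨i, by simp only [num]; omega, ?_⟩
        simp only [expand, if_pos hi]
        exact ⟨h1, h.2⟩

theorem expand_expand_le {t s : DTree} {i j : ℕ} (hi : i < t.num) (hj : j < t.num) (hij : i ≠ j)
    (h1 : le (t.expand i) s) (h2 : le (t.expand j) s) : le ((t.expand i).expand (up i j)) s := by
  induction t generalizing s i j with
  | leaf => simp only [num] at hi hj; omega
  | node l r ihl ihr =>
    simp only [num] at hi hj
    cases s with
    | leaf =>
      simp only [expand] at h1
      split_ifs at h1 <;> exact h1.elim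
    | node l' r' =>
      by_cases h : i < l.num <;> by_cases h' : j < l.num
      · simp only [expand, if_pos h, if_pos h', num_expand h] at *
        rw [if_pos (by unfold up; split_ifs <;> omega)]
        exact ⟨ihl h h' hij h1.1 h2.1, h1.2⟩
      · simp only [expand, if_pos h, if_neg h', num_expand h] at *
        rw [if_neg (by unfold up; split_ifs <;> omega)]
        have : up i j - (l.num + 1) = j - l.num := by unfold up; split_ifs <;> omega
        rw [this]
        exact ⟨h1.1, h2.2⟩
      · simp only [expand, if_neg h, if_pos h'] at *
        rw [if_pos (by unfold up; split_ifs <;> omega)]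
        have : up i j = j := by unfold up; split_ifs <;> omega
        rw [this]
        exact ⟨h2.1, h1.2⟩
      · simp only [expand, if_neg h, if_neg h'] at *
        rw [if_neg (by unfold up; split_ifs <;> omega)]
        have : up i j - l.num = up (i - l.num) (j - l.num) := by unfold up; split_ifs <;> omega
        rw [this]
        exact ⟨h1.1, ihr (by omega) (by omega) (by omega) h1.2 h2.2⟩

theorem word_node_left (l r : DTree) {i : ℕ} (hi : i < l.num) :
    (node l r).word i = false :: l.word i := by simp [word, hi]

theorem word_node_right (l r : DTree) (i : ℕ) :
    (node l r).word (l.num + i) = true :: r.word i := by simp [word]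

/-- A tree is determined by its leaves. -/
theorem eq_of_words {t s : DTree} (h : ∀ i < t.num, ∃ j < s.num, t.word i = s.word j) :
    t = s := by
  induction t generalizing s with
  | leaf =>
    obtain ⟨j, hj, h⟩ := h 0 (by simp [num])
    cases s with
    | leaf => rfl
    | node l r =>
      simp only [word] at h
      split_ifs at h
  | node l r ihl ihr =>
    cases s with
    | leaf =>
      obtain ⟨j, hj, h⟩ := h 0 (num_pos _)
      simp only [word] at h
      split_ifs at h
    | node l' r' =>
      congr 1
      · refine ihl fun i hi => ?_
        obtain ⟨j, hj, h⟩ := h i (by simp only [num]; omega)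
        rw [word_node_left _ _ hi] at h
        by_cases hj' : j < l'.num
        · rw [word_node_left _ _ hj'] at h
          exact ⟨j, hj', by simpa using h⟩
        · simp [word, hj'] at h
      · refine ihr fun i hi => ?_
        obtain ⟨j, hj, h⟩ := h (l.num + i) (by simp only [num]; omega)
        rw [word_node_right] at h
        by_cases hj' : j < l'.num
        · simp [word, hj'] at h
        · simp only [num] at hj
          refine ⟨j - l'.num, by omega, ?_⟩
          simpa [word, hj'] using h

/-- Every end of the dyadic tree passes through a leaf. -/
theorem exists_word (t : DTree) (x : Stream' Bool) :
    ∃ i < t.num, x.take (t.word i).length = t.word i := by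
  induction t generalizing x with
  | leaf => exact ⟨0, by simp [num], rfl⟩
  | node l r ihl ihr =>
    rcases hx : x.head with _ | _
    · obtain ⟨i, hi, h⟩ := ihl x.tail
      refine ⟨i, by simp only [num]; omega, ?_⟩
      rw [word_node_left _ _ hi, List.length_cons, Stream'.take_succ, hx, h]
    · obtain ⟨i, hi, h⟩ := ihr x.tail
      refine ⟨l.num + i, by simp only [num]; omega, ?_⟩
      rw [word_node_right, List.length_cons, Stream'.take_succ, hx, h]

theorem word_unique (t : DTree) (x : Stream' Bool) {i j : ℕ} (hi : i < t.num) (hj : j < t.num)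
    (h1 : x.take (t.word i).length = t.word i) (h2 : x.take (t.word j).length = t.word j) :
    i = j := by
  induction t generalizing x i j with
  | leaf => simp only [num] at hi hj; omega
  | node l r ihl ihr =>
    simp only [num] at hi hj
    by_cases h : i < l.num <;> by_cases h' : j < l.num
    · simp only [word, if_pos h, if_pos h', List.length_cons, Stream'.take_succ,
        List.cons.injEq] at h1 h2
      exact ihl _ h h' h1.2 h2.2
    · simp only [word, if_pos h, if_neg h', List.length_cons, Stream'.take_succ,
        List.cons.injEq] at h1 h2
      rw [h1.1] at h2; simp at h2
    · simp only [word, if_neg h, if_pos h', List.length_cons, Stream'.take_succ,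
        List.cons.injEq] at h1 h2
      rw [h1.1] at h2; simp at h2
    · simp only [word, if_neg h, if_neg h', List.length_cons, Stream'.take_succ,
        List.cons.injEq] at h1 h2
      have := ihr _ (by omega) (by omega) h1.2 h2.2
      omega

/-- The tree obtained by growing from the address `w` until a word satisfying `P` is met. -/
noncomputable def build (P : List Bool → Prop) : ℕ → List Bool → DTree
  | 0, _ => leaf
  | K + 1, w => open Classical in
      if P w then leaf else node (build P K (w ++ [false])) (build P K (w ++ [true]))

theorem build_word (P : List Bool → Prop) (K : ℕ) (w : List Bool)
    (h : ∀ z : List Bool, z.length = K → ∃ z', z' <+: z ∧ P (w ++ z')) (i : ℕ) :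
    P (w ++ (build P K w).word i) := by
  induction K generalizing w i with
  | zero =>
    obtain ⟨z', h1, h2⟩ := h [] rfl
    simpa [build, word, List.prefix_nil.1 h1] using h2
  | succ K ih =>
    unfold build
    split_ifs with hw
    · simpa [word] using hw
    · have key : ∀ b i, P ((w ++ [b]) ++ (build P K (w ++ [b])).word i) := by
        refine fun b => ih _ fun z hz => ?_
        obtain ⟨z', h1, h2⟩ := h (b :: z) (by simp [hz])
        cases z' with
        | nil => simp at h2; exact (hw h2).elim
        | cons c z' =>
          obtain ⟨h3, h4⟩ := List.cons_prefix_cons.1 h1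
          subst h3
          exact ⟨z', h4, by simpa using h2⟩
      simp only [word]
      split_ifs
      · simpa using key false i
      · simpa using key true _

theorem word_full_length (k i : ℕ) : ((full k).word i).length = k := by
  induction k generalizing i with
  | zero => rfl
  | succ k ih => simp only [full, word]; split_ifs <;> simp [ih]

end DTree

/-! ### Neretin's group -/

/-- The bijection `g` of the set of ends of the infinite rooted dyadic tree (i.e. of infinite binary
sequences) maps the ends of the dyadic subtree `T_u` rooted at `u` onto those of `T_v`, and it
is induced there by an isomorphism of rooted trees `T_u → T_v`: two ends of `T_u` have the same
vertex at depth `k` of `T_u` if and only if their images have the same vertex at depth `k`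
of `T_v`. -/
def IsTreeIso (g : Equiv.Perm (Stream' Bool)) (u v : List Bool) : Prop :=
  (∀ x : Stream' Bool, x.take u.length = u ↔ (g x).take v.length = v) ∧
  ∀ x y : Stream' Bool, x.take u.length = u → y.take u.length = u → ∀ k : ℕ,
    (x.take (u.length + k) = y.take (u.length + k) ↔
      (g x).take (v.length + k) = (g y).take (v.length + k))

/-- Whether the tree isomorphism `T_u → T_v` induced by `g` exchanges the left and the right
halves. -/
def swaps (g : Equiv.Perm (Stream' Bool)) (u v : List Bool) : Bool :=
  (g (u ++ₛ Stream'.const false)).get v.length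

theorem take_app (u : List Bool) (x : Stream' Bool) : (u ++ₛ x).take u.length = u := by
  have := Stream'.append_take (x := u) (a := x) (n := 0)
  simpa using this.symm

theorem take_snoc (x : Stream' Bool) (u : List Bool) (b : Bool) :
    x.take (u ++ [b]).length = u ++ [b] ↔ x.take u.length = u ∧ x.get u.length = b := by
  rw [List.length_append, List.length_singleton, Stream'.take_succ']
  constructor
  · intro h
    have := List.append_inj h (by simp)
    exact ⟨this.1, by simpa using this.2⟩
  · rintro ⟨h1, h2⟩; rw [h1, h2]

theorem perm_apply_inv {α : Type*} (g : Equiv.Perm α) (x : α) : g (g⁻¹ x) = x :=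
  Equiv.apply_symm_apply g x

theorem perm_inv_apply {α : Type*} (g : Equiv.Perm α) (x : α) : g⁻¹ (g x) = x :=
  Equiv.symm_apply_apply g x

namespace IsTreeIso

variable {g h : Equiv.Perm (Stream' Bool)} {u v w : List Bool}

theorem get_eq (hg : IsTreeIso g u v) {x : Stream' Bool} (hx : x.take u.length = u) :
    (g x).get v.length = xor (x.get u.length) (swaps g u v) := by
  have hz := take_app u (Stream'.const false)
  have h2 := hg.2 x _ hx hz 1
  rw [Stream'.take_succ', Stream'.take_succ', Stream'.take_succ', Stream'.take_succ', hx, hz,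
    (hg.1 x).1 hx, (hg.1 _).1 hz] at h2
  have h3 : (u ++ₛ Stream'.const false).get u.length = false := by
    rw [Stream'.get_append_length]; rfl
  rw [h3] at h2
  change _ ↔ _ = v ++ [swaps g u v] at h2
  simp only [List.append_cancel_left_eq, List.cons.injEq, and_true] at h2
  revert h2
  cases x.get u.length <;> cases (g x).get v.length <;> cases swaps g u v <;> simp

theorem child (hg : IsTreeIso g u v) (b : Bool) :
    IsTreeIso g (u ++ [b]) (v ++ [xor b (swaps g u v)]) := by
  constructor
  · intro x
    rw [take_snoc, take_snoc, ← hg.1 x]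
    constructor
    · rintro ⟨h1, h2⟩
      exact ⟨h1, by rw [hg.get_eq h1, h2]⟩
    · rintro ⟨h1, h2⟩
      rw [hg.get_eq h1] at h2
      exact ⟨h1, by simpa using h2⟩
  · intro x y hx hy k
    rw [take_snoc] at hx hy
    have := hg.2 x y hx.1 hy.1 (1 + k)
    simpa [add_assoc] using this

theorem desc (hg : IsTreeIso g u v) (w : List Bool) :
    ∃ w' : List Bool, w'.length = w.length ∧ IsTreeIso g (u ++ w) (v ++ w') := by
  induction w generalizing u v with
  | nil => exact ⟨[], rfl, by simpa using hg⟩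
  | cons b w ih =>
    obtain ⟨w', h1, h2⟩ := ih (hg.child b)
    exact ⟨xor b (swaps g u v) :: w', by simp [h1], by simpa using h2⟩

theorem one (u : List Bool) : IsTreeIso 1 u u := ⟨fun _ => Iff.rfl, fun _ _ _ _ _ => Iff.rfl⟩

theorem mul (hh : IsTreeIso h v w) (hg : IsTreeIso g u v) : IsTreeIso (h * g) u w :=
  ⟨fun x => (hg.1 x).trans (hh.1 _), fun x y hx hy k => (hg.2 x y hx hy k).trans
    (hh.2 _ _ ((hg.1 x).1 hx) ((hg.1 y).1 hy) k)⟩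

theorem inv (hg : IsTreeIso g u v) : IsTreeIso g⁻¹ v u := by
  refine ⟨fun x => ?_, fun x y hx hy k => ?_⟩
  · have := hg.1 (g⁻¹ x)
    rw [perm_apply_inv] at this
    exact this.symm
  · have := hg.2 (g⁻¹ x) (g⁻¹ y)
    simp only [hg.1, perm_apply_inv] at this
    exact (this hx hy k).symm

theorem swaps_mul (hh : IsTreeIso h v w) (hg : IsTreeIso g u v) :
    swaps (h * g) u w = xor (swaps h v w) (swaps g u v) := by
  have hz := take_app u (Stream'.const false)
  have := hh.get_eq ((hg.1 _).1 hz)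
  unfold swaps at *
  rw [Equiv.Perm.mul_apply, this, Bool.xor_comm]

theorem swaps_one (u : List Bool) : swaps 1 u u = false := by
  unfold swaps
  rw [Equiv.Perm.one_apply, Stream'.get_append_length]; rfl

theorem swaps_inv (hg : IsTreeIso g u v) : swaps g⁻¹ v u = swaps g u v := by
  have := swaps_mul hg.inv hg
  rw [inv_mul_cancel, swaps_one] at this
  revert this
  cases swaps g⁻¹ v u <;> cases swaps g u v <;> simp

theorem prefix_unique (hg : IsTreeIso g u v) (hg' : IsTreeIso g u w) : v = w := by
  have key : ∀ v w : List Bool, IsTreeIso g u v → IsTreeIso g u w → ¬ v.length < w.length := by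
    intro v w hv hw hlt
    have hbad : ∀ x : Stream' Bool, x.take v.length = v → x.take w.length = w := by
      intro x hx
      have h1 := (hv.1 (g⁻¹ x)).2 (by simpa using hx)
      simpa using (hw.1 _).1 h1
    have h1 := hbad _ (take_app v (Stream'.const false))
    have h2 := hbad _ (take_app v (Stream'.const true))
    have h3 : ∀ x : Stream' Bool, x.take w.length = w →
        w[v.length]? = some (x.get v.length) := by
      intro x hx
      rw [← hx, Stream'.getElem?_take hlt]
    have h4 := (h3 _ h1).symm.trans (h3 _ h2)
    simp [Stream'.get_append_length] at h4
  have hl : v.length = w.length :=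
    _root_.le_antisymm (not_lt.1 (key w v hg' hg)) (not_lt.1 (key v w hg hg'))
  have hz := take_app u (Stream'.const false)
  have h1 := (hg.1 _).1 hz
  have h2 := (hg'.1 _).1 hz
  rw [hl] at h1
  exact h1.symm.trans h2

end IsTreeIso

/-- Neretin's spheromorphism group `N` of the infinite rooted dyadic tree, as a group of
bijections of its set of ends: the bijections `g` such that, for some `k`, each of the `2^k` subtrees
hanging from the leaves of `T_{2^k}` is mapped by a tree isomorphism onto a dyadic subtree.
(See `exists_symbol` below for the target tree.) -/
def N : Subgroup (Equiv.Perm (Stream' Bool)) where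
  carrier := {g | ∃ k : ℕ, ∀ u : List Bool, u.length = k → ∃ v : List Bool, IsTreeIso g u v}
  one_mem' := ⟨0, fun u _ => ⟨u, IsTreeIso.one u⟩⟩
  mul_mem' := by
    rintro h g ⟨k, hk⟩ ⟨l, hl⟩
    refine ⟨l + k, fun u hu => ?_⟩
    obtain ⟨v, hv⟩ := hl (u.take l) (by simp; omega)
    obtain ⟨w, hw, h1⟩ := hv.desc (u.drop l)
    rw [List.take_append_drop] at h1
    obtain ⟨x, hx⟩ := hk ((v ++ w).take k) (by simp [hw]; omega)
    obtain ⟨y, -, h2⟩ := hx.desc ((v ++ w).drop k)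
    rw [List.take_append_drop] at h2
    exact ⟨_, h2.mul h1⟩
  inv_mem' := by
    rintro g ⟨k, hk⟩
    choose! f hf using hk
    obtain ⟨K, hK⟩ : ∃ K, ∀ u : List Bool, u.length = k → (f u).length ≤ K := by
      have hfin : {u : List Bool | u.length = k}.Finite := List.finite_length_eq Bool k
      obtain ⟨K, hK⟩ := (hfin.image fun u => (f u).length).bddAbove
      exact ⟨K, fun u hu => hK ⟨u, hu, rfl⟩⟩
    refine ⟨K, fun w hw => ?_⟩
    set x := w ++ₛ Stream'.const false with hx
    set u := (g⁻¹ x).take k with hu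
    have hul : u.length = k := by simp [hu]
    have h1 := hf u hul
    have h2 := (h1.1 (g⁻¹ x)).1 (by rw [hul])
    rw [perm_apply_inv] at h2
    have h3 : f u <+: w := by
      rw [← take_app w (Stream'.const false), ← h2, ← hx]
      rw [Stream'.take_prefix, hw]
      exact hK u hul
    obtain ⟨z, hz⟩ := h3
    obtain ⟨y, -, h4⟩ := h1.inv.desc z
    rw [hz] at h4
    exact ⟨_, h4⟩
/-! ### The quasi-braid extension of Neretin's group -/

/-- A symbol `(tgt, src, q_σ)` for an element `g` of Neretin's group, lifted to quasi-braids: `src`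
and `tgt` are dyadic trees with `n` leaves, and `σ ∈ J_n` is a quasi-braid whose permutation tells
onto which of the subtrees hanging from the leaves of `tgt` the subtrees hanging from the
leaves of `src` are mapped by `g`.  The tree isomorphisms between these subtrees are determined by
`g`. -/
@[ext] structure Symbol (n : ℕ) where
  g : N
  src : DTree
  tgt : DTree
  σ : J n
  num_src : src.num = n
  num_tgt : tgt.num = n
  iso : ∀ i < n, IsTreeIso g.1 (src.word i) (tgt.word (toPerm n σ i))

namespace Symbol

variable {n : ℕ}

/-- Whether the tree isomorphism hanging from the `i`-th leaf of the source exchanges the left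
and right halves. -/
def eps (f : Symbol n) (i : ℕ) : Bool :=
  swaps f.g.1 (f.src.word i) (f.tgt.word (toPerm n f.σ i))

/-- The power of the quasi-braid transposition `α_{(i, i+1)}` with exponent `0` or `1`. -/
def tauPow (n i : ℕ) (b : Bool) : J n := if b then tau n i else 1

theorem tauPow_xor (n i : ℕ) (b c : Bool) :
    tauPow n i (xor b c) = tauPow n i b * tauPow n i c := by
  cases b <;> cases c <;> simp [tauPow, tau_sq]

theorem tauPow_mul_expand (σ : J n) (i : ℕ) (b : Bool) :
    tauPow (n + 1) (toPerm n σ i) b * NeretinEuler.expand i σ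
      = NeretinEuler.expand i σ * tauPow (n + 1) i b := by
  cases b
  · simp [tauPow]
  · simpa [tauPow] using tau_mul_expand σ i

theorem tauPow_inv (n i : ℕ) (b : Bool) : (tauPow n i b)⁻¹ = tauPow n i b := by
  cases b
  · simp [tauPow]
  · simpa [tauPow] using inv_eq_of_mul_eq_one_left (tau_sq n i)

theorem toPerm_tauPow_of_ne {i k : ℕ} (hi : i + 1 < n) (b : Bool) (h1 : k ≠ i)
    (h2 : k ≠ i + 1) : toPerm n (tauPow n i b) k = k := by
  cases b
  · simp [tauPow]
  · simp only [tauPow, if_true]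
    rw [toPerm_tau hi, rev_apply]
    split_ifs <;> omega

theorem toPerm_tauPow_left {i : ℕ} (hi : i + 1 < n) (b : Bool) :
    toPerm n (tauPow n i b) i = if b then i + 1 else i := by
  cases b
  · simp [tauPow]
  · simp only [tauPow, if_true]
    rw [toPerm_tau hi, rev_apply]
    split_ifs <;> omega

theorem toPerm_tauPow_right {i : ℕ} (hi : i + 1 < n) (b : Bool) :
    toPerm n (tauPow n i b) (i + 1) = if b then i else i + 1 := by
  cases b
  · simp [tauPow]
  · simp only [tauPow, if_true]
    rw [toPerm_tau hi, rev_apply]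
    split_ifs <;> omega

theorem exists_up {i k : ℕ} (h : k ≠ i + 1) : ∃ k', k = up i k' ∧ (k = i ↔ k' = i) := by
  rcases lt_or_ge i k with h' | h'
  · exact ⟨k - 1, by unfold up; split_ifs <;> omega, by omega⟩
  · exact ⟨k, by unfold up; split_ifs <;> omega, by omega⟩

theorem up_self (i : ℕ) : up i i = i := by unfold up; simp

theorem up_lt {i k : ℕ} (hi : i < n) : up i k < n + 1 ↔ k < n := by
  unfold up; split_ifs <;> omega

/-- The simple expansion of a symbol at the `i`-th leaf of its source tree: the quasi-braid
is expanded at `i`, and it is moreover twisted by the quasi-braid transposition `α_{(i, i+1)}`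
if the `i`-th tree isomorphism exchanges the two halves. -/
def expand (f : Symbol n) (i : ℕ) (hi : i < n) : Symbol (n + 1) where
  g := f.g
  src := f.src.expand i
  tgt := f.tgt.expand (toPerm n f.σ i)
  σ := NeretinEuler.expand i f.σ * tauPow (n + 1) i (f.eps i)
  num_src := by rw [DTree.num_expand (by rw [f.num_src]; exact hi), f.num_src]
  num_tgt := by
    rw [DTree.num_expand (by rw [f.num_tgt]; exact (toPerm_lt _ _).2 hi), f.num_tgt]
  iso := by
    intro k hk
    have hi' := (toPerm_lt f.σ i).2 hi
    have hs : i < f.src.num := by rw [f.num_src]; exact hi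
    have ht : toPerm n f.σ i < f.tgt.num := by rw [f.num_tgt]; exact hi'
    have hiso := f.iso i hi
    have hl := DTree.word_expand hs hs
    have hl' := DTree.word_expand ht ht
    rw [up_self, if_pos rfl] at hl hl'
    have hr := DTree.word_expand_succ hs
    have hr' := DTree.word_expand_succ ht
    have e1 := toPerm_expand f.σ i i
    rw [up_self, up_self] at e1
    rw [map_mul, Equiv.Perm.mul_apply]
    by_cases h1 : k = i
    · subst h1
      rw [toPerm_tauPow_left (by omega), hl]
      have := hiso.child false
      cases h : f.eps k
      · simp only [Bool.false_eq_true, if_false]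
        rw [e1.1, hl']
        unfold eps at h
        rw [h] at this
        simpa using this
      · simp only [if_true]
        rw [e1.2, hr']
        unfold eps at h
        rw [h] at this
        simpa using this
    by_cases h2 : k = i + 1
    · subst h2
      rw [toPerm_tauPow_right (by omega), hr]
      have := hiso.child true
      cases h : f.eps i
      · simp only [Bool.false_eq_true, if_false]
        rw [e1.2, hr']
        unfold eps at h
        rw [h] at this
        simpa using this
      · simp only [if_true]
        rw [e1.1, hl']
        unfold eps at h
        rw [h] at this
        simpa using this
    · rw [toPerm_tauPow_of_ne (by omega) _ h1 h2]
      obtain ⟨k', rfl, hk'⟩ := exists_up h2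
      have hk'n : k' < n := (up_lt hi).1 hk
      have hne : k' ≠ i := fun h => h1 (hk'.2 h)
      rw [DTree.word_expand hs (by rw [f.num_src]; exact hk'n), if_neg hne,
        (toPerm_expand f.σ i k').1, DTree.word_expand ht
          (by rw [f.num_tgt]; exact (toPerm_lt _ _).2 hk'n),
        if_neg fun h => hne ((toPerm n f.σ).injective h)]
      exact f.iso k' hk'n

/-- Composition `f₂ f₁` of two symbols such that the target tree of `f₁` is the source tree
of `f₂`. -/
def comp (f₂ f₁ : Symbol n) (h : f₁.tgt = f₂.src) : Symbol n where
  g := f₂.g * f₁.g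
  src := f₁.src
  tgt := f₂.tgt
  σ := f₂.σ * f₁.σ
  num_src := f₁.num_src
  num_tgt := f₂.num_tgt
  iso := by
    intro i hi
    rw [map_mul, Equiv.Perm.mul_apply]
    have h2 := f₂.iso _ ((toPerm_lt f₁.σ i).2 hi)
    rw [← h] at h2
    exact h2.mul (f₁.iso i hi)

/-- The inverse symbol. -/
def inv (f : Symbol n) : Symbol n where
  g := f.g⁻¹
  src := f.tgt
  tgt := f.src
  σ := f.σ⁻¹
  num_src := f.num_tgt
  num_tgt := f.num_src
  iso := by
    intro i hi
    have := f.iso (toPerm n f.σ⁻¹ i) ((toPerm_lt _ _).2 hi)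
    rw [map_inv, perm_apply_inv] at this
    rw [map_inv]
    exact this.inv

/-- The identity symbol of a tree. -/
def ident (t : DTree) : Symbol t.num where
  g := 1
  src := t
  tgt := t
  σ := 1
  num_src := rfl
  num_tgt := rfl
  iso := by
    intro i _
    rw [map_one]
    exact IsTreeIso.one _

theorem expand_expand (f : Symbol n) {i j : ℕ} (hi : i < n) (hj : j < n) (hij : i ≠ j) :
    (f.expand i hi).expand (up i j) ((up_lt hi).2 hj)
      = (f.expand j hj).expand (up j i) ((up_lt hj).2 hi) := by
  have eps_eq : ∀ i j (hi : i < n) (hj : j < n), i ≠ j →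
      (f.expand i hi).eps (up i j) = f.eps j := by
    intro i j hi hj hij
    have hs : i < f.src.num := by rw [f.num_src]; exact hi
    have hne : up i j ≠ i := by unfold up; split_ifs <;> omega
    have hne' : up i j ≠ i + 1 := by unfold up; split_ifs <;> omega
    unfold eps
    simp only [expand]
    rw [DTree.word_expand hs (by rw [f.num_src]; exact hj), if_neg hij.symm, map_mul,
      Equiv.Perm.mul_apply, toPerm_tauPow_of_ne (by omega) _ hne hne',
      (toPerm_expand f.σ i j).1, DTree.word_expand
        (by rw [f.num_tgt]; exact (toPerm_lt _ _).2 hi)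
        (by rw [f.num_tgt]; exact (toPerm_lt _ _).2 hj),
      if_neg fun h => hij ((toPerm n f.σ).injective h).symm]
  have perm_eq : ∀ i j (hi : i < n) (hj : j < n), i ≠ j →
      toPerm (n + 1) (f.expand i hi).σ (up i j) = up (toPerm n f.σ i) (toPerm n f.σ j) := by
    intro i j hi hj hij
    have hne : up i j ≠ i := by unfold up; split_ifs <;> omega
    have hne' : up i j ≠ i + 1 := by unfold up; split_ifs <;> omega
    simp only [expand]
    rw [map_mul, Equiv.Perm.mul_apply, toPerm_tauPow_of_ne (by omega) _ hne hne',
      (toPerm_expand f.σ i j).1]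
  have brd : ∀ i j (hi : i < n) (hj : j < n), i ≠ j →
      NeretinEuler.expand (up i j) (f.expand i hi).σ
        = NeretinEuler.expand (up i j) (NeretinEuler.expand i f.σ)
          * tauPow (n + 2) (up j i) (f.eps i) := by
    intro i j hi hj hij
    have hne : up i j ≠ i := by unfold up; split_ifs <;> omega
    have hne' : up i j ≠ i + 1 := by unfold up; split_ifs <;> omega
    simp only [expand]
    rw [expand_mul, toPerm_tauPow_of_ne (by omega) _ hne hne']
    congr 1
    cases f.eps i
    · simp [tauPow, expand_one]
    · simp only [tauPow, if_true]
      rw [expand_tau (by omega) hne hne']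
      congr 1
      unfold up; split_ifs <;> omega
  have comm : ∀ b c, tauPow (n + 2) (up j i) b * tauPow (n + 2) (up i j) c
      = tauPow (n + 2) (up i j) c * tauPow (n + 2) (up j i) b := by
    intro b c
    cases b <;> cases c <;> simp only [tauPow, if_true, Bool.false_eq_true, if_false, mul_one,
      one_mul]
    rcases lt_or_gt_of_ne hij with h | h
    · exact tau_comm (by unfold up; split_ifs <;> omega)
    · exact (tau_comm (by unfold up; split_ifs <;> omega)).symm
  refine Symbol.ext rfl ?_ ?_ ?_
  · exact DTree.expand_comm (by rw [f.num_src]; exact hi) (by rw [f.num_src]; exact hj) hij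
  · change DTree.expand (f.tgt.expand _) _ = DTree.expand (f.tgt.expand _) _
    rw [perm_eq i j hi hj hij, perm_eq j i hj hi hij.symm]
    exact DTree.expand_comm (by rw [f.num_tgt]; exact (toPerm_lt _ _).2 hi)
      (by rw [f.num_tgt]; exact (toPerm_lt _ _).2 hj) fun h => hij ((toPerm n f.σ).injective h)
  · change NeretinEuler.expand _ (f.expand i hi).σ * tauPow (n + 2) _ _
      = NeretinEuler.expand _ (f.expand j hj).σ * tauPow (n + 2) _ _
    rw [brd i j hi hj hij, brd j i hj hi hij.symm, eps_eq i j hi hj hij,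
      eps_eq j i hj hi hij.symm, NeretinEuler.expand_expand f.σ hij, mul_assoc, mul_assoc, comm]

theorem comp_expand (f₂ f₁ : Symbol n) (h : f₁.tgt = f₂.src) {i : ℕ} (hi : i < n) :
    ∃ h', (comp f₂ f₁ h).expand i hi
      = comp (f₂.expand (toPerm n f₁.σ i) ((toPerm_lt _ _).2 hi)) (f₁.expand i hi) h' := by
  have h' : (f₁.expand i hi).tgt
      = (f₂.expand (toPerm n f₁.σ i) ((toPerm_lt _ _).2 hi)).src := by
    simp only [expand]; rw [h]
  refine ⟨h', Symbol.ext rfl rfl ?_ ?_⟩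
  · simp only [expand, comp]
    rw [map_mul, Equiv.Perm.mul_apply]
  · have he : (comp f₂ f₁ h).eps i = xor (f₂.eps (toPerm n f₁.σ i)) (f₁.eps i) := by
      have h2 := f₂.iso _ ((toPerm_lt f₁.σ i).2 hi)
      rw [← h] at h2
      have := h2.swaps_mul (f₁.iso i hi)
      unfold eps
      simp only [comp]
      rw [map_mul, Equiv.Perm.mul_apply, ← h]
      exact this
    change NeretinEuler.expand i (f₂.σ * f₁.σ) * tauPow (n + 1) i _
      = (NeretinEuler.expand _ f₂.σ * tauPow (n + 1) _ _)
        * (NeretinEuler.expand i f₁.σ * tauPow (n + 1) i _)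
    rw [he, expand_mul, tauPow_xor]
    simp only [mul_assoc]
    rw [← mul_assoc (tauPow (n + 1) (toPerm n f₁.σ i) _), tauPow_mul_expand, mul_assoc]

theorem inv_expand (f : Symbol n) {i : ℕ} (hi : i < n) :
    f.inv.expand (toPerm n f.σ i) ((toPerm_lt _ _).2 hi) = (f.expand i hi).inv := by
  refine Symbol.ext rfl rfl ?_ ?_
  · simp only [expand, inv]
    rw [map_inv, perm_inv_apply]
  · have he : f.inv.eps (toPerm n f.σ i) = f.eps i := by
      have := (f.iso i hi).swaps_inv
      unfold eps
      simp only [inv]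
      rw [map_inv, perm_inv_apply]
      exact this
    change NeretinEuler.expand _ f.σ⁻¹ * tauPow (n + 1) _ _
      = (NeretinEuler.expand i f.σ * tauPow (n + 1) i _)⁻¹
    rw [he, expand_inv, mul_inv_rev, tauPow_inv, ← mul_inv_eq_iff_eq_mul.2
      (tauPow_mul_expand f.σ i (f.eps i)).symm]
    group

theorem ident_expand (t : DTree) {i : ℕ} (hi : i < t.num) :
    (⟨t.num + 1, (ident t).expand i hi⟩ : Σ n, Symbol n)
      = ⟨(t.expand i).num, ident (t.expand i)⟩ := by
  have key : ∀ (m : ℕ) (f : Symbol m), f.g = 1 → f.src = t.expand i → f.tgt = t.expand i →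
      f.σ = 1 → (⟨m, f⟩ : Σ n, Symbol n) = ⟨(t.expand i).num, ident (t.expand i)⟩ := by
    intro m f h1 h2 h3 h4
    have hm : m = (t.expand i).num := by rw [← h2, f.num_src]
    subst hm
    congr 1
    exact Symbol.ext h1 h2 h3 h4
  refine key _ _ rfl rfl ?_ ?_
  · simp only [expand, ident]; rw [map_one]; rfl
  · have : (ident t).eps i = false := by
      unfold eps
      simp only [ident]
      rw [map_one]
      exact IsTreeIso.swaps_one _
    change NeretinEuler.expand i 1 * tauPow _ i _ = 1
    rw [this, expand_one]; simp [tauPow]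

end Symbol

/-- All symbols. -/
abbrev Sym : Type := Σ n, Symbol n

/-- `Step a b`: the symbol `b` is a simple expansion of `a`. -/
inductive Step : Sym → Sym → Prop
  | mk {n : ℕ} (f : Symbol n) (i : ℕ) (hi : i < n) : Step ⟨n, f⟩ ⟨n + 1, f.expand i hi⟩

/-- `Expn a b`: the symbol `b` is an (iterated) expansion of `a`. -/
abbrev Expn : Sym → Sym → Prop := Relation.ReflTransGen Step

theorem Step.num {a b : Sym} (h : Step a b) : b.1 = a.1 + 1 := by cases h; rfl

theorem Step.src_le {a b : Sym} (h : Step a b) : DTree.le a.2.src b.2.src := by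
  cases h; exact DTree.le_expand _ _

theorem Step.g_eq {a b : Sym} (h : Step a b) : b.2.g = a.2.g := by
  cases h; rfl

theorem Expn.num {a b : Sym} (h : Expn a b) : a.1 ≤ b.1 := by
  induction h with
  | refl => exact le_rfl
  | tail _ h ih => rw [h.num]; omega

theorem Expn.src_le {a b : Sym} (h : Expn a b) : DTree.le a.2.src b.2.src := by
  induction h with
  | refl => exact DTree.le_refl _
  | tail _ h ih => exact DTree.le_trans ih h.src_le

theorem Expn.g_eq {a b : Sym} (h : Expn a b) : b.2.g = a.2.g := by
  induction h with
  | refl => rfl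
  | tail _ h ih => rw [h.g_eq, ih]

theorem Expn.exists_src (a : Sym) (t : DTree) (h : DTree.le a.2.src t) :
    ∃ b, Expn a b ∧ b.2.src = t := by
  induction hk : t.num - a.1 using Nat.strong_induction_on generalizing a with
  | _ k ih =>
    rcases DTree.eq_or_expand_le h with h1 | ⟨i, hi, h1⟩
    · exact ⟨a, .refl, h1⟩
    · obtain ⟨n, f⟩ := a
      simp only at hi h1 hk
      have hi' : i < n := by rw [← f.num_src]; exact hi
      have h2 := DTree.num_le h1
      rw [DTree.num_expand hi, f.num_src] at h2
      obtain ⟨b, hb, hb'⟩ := ih (t.num - (n + 1)) (by omega) ⟨n + 1, f.expand i hi'⟩ h1 rfl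
      exact ⟨b, .head (Step.mk f i hi') hb, hb'⟩

theorem Expn.unique {a b c : Sym} (h1 : Expn a b) (h2 : Expn a c) (h : b.2.src = c.2.src) :
    b = c := by
  induction hk : b.1 - a.1 using Nat.strong_induction_on generalizing a b c with
  | _ k ih =>
    have hbc : b.1 = c.1 := by rw [← b.2.num_src, ← c.2.num_src, h]
    rcases Relation.ReflTransGen.cases_head h1 with rfl | ⟨b', hs, hb⟩
    · rcases Relation.ReflTransGen.cases_head h2 with rfl | ⟨c', hs, hc⟩
      · rfl
      · have := hs.num; have := Expn.num hc; omega
    · rcases Relation.ReflTransGen.cases_head h2 with rfl | ⟨c', hs', hc⟩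
      · have := hs.num; have := Expn.num hb; omega
      · have e1 := hs.num
        have e2 := Expn.num hb
        have e3 := hs'.num
        cases hs with
        | mk f i hi =>
          cases hs' with
          | mk _ j hj =>
            rename_i n
            simp only at e1 e2 e3 hk
            by_cases hij : i = j
            · subst hij
              exact ih (b.1 - (n + 1)) (by omega) hb hc h rfl
            · have hle := DTree.expand_expand_le (by rw [f.num_src]; exact hi)
                (by rw [f.num_src]; exact hj) hij (Expn.src_le hb) (h ▸ Expn.src_le hc)
              obtain ⟨d, hd, hd'⟩ := Expn.exists_src
                ⟨n + 1 + 1, (f.expand i hi).expand (up i j) ((Symbol.up_lt hi).2 hj)⟩ b.2.src hle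
              have s1 := Step.mk (f.expand i hi) (up i j) ((Symbol.up_lt hi).2 hj)
              have s2 := Step.mk (f.expand j hj) (up j i) ((Symbol.up_lt hj).2 hi)
              rw [← f.expand_expand hi hj hij] at s2
              have hdb : d.1 = b.1 := by rw [← d.2.num_src, ← b.2.num_src, hd']
              have t1 := ih (b.1 - (n + 1)) (by omega) hb (.head s1 hd) hd'.symm rfl
              have t2 := ih (d.1 - (n + 1)) (by omega) (.head s2 hd) hc (hd'.trans h) rfl
              exact t1.trans t2
/-- The inverse of a symbol. -/
def symInv (a : Sym) : Sym := ⟨a.1, a.2.inv⟩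

theorem symInv_symInv (a : Sym) : symInv (symInv a) = a := by
  obtain ⟨n, f⟩ := a
  simp only [symInv]
  congr 1
  exact Symbol.ext (inv_inv _) rfl rfl (inv_inv _)

theorem Step.symInv {a b : Sym} (h : Step a b) : Step (symInv a) (symInv b) := by
  cases h with
  | mk f i hi =>
    have := Step.mk f.inv (toPerm _ f.σ i) ((toPerm_lt _ _).2 hi)
    rw [f.inv_expand hi] at this
    exact this

theorem Expn.symInv {a b : Sym} (h : Expn a b) : Expn (symInv a) (symInv b) := by
  induction h with
  | refl => exact .refl
  | tail _ h ih => exact ih.tail h.symInv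

theorem Expn.exists_tgt (a : Sym) (t : DTree) (h : DTree.le a.2.tgt t) :
    ∃ b, Expn a b ∧ b.2.tgt = t := by
  obtain ⟨b, h1, h2⟩ := Expn.exists_src (NeretinEuler.symInv a) t h
  refine ⟨NeretinEuler.symInv b, ?_, h2⟩
  have := h1.symInv
  rwa [symInv_symInv] at this

theorem Expn.tgt_le {a b : Sym} (h : Expn a b) : DTree.le a.2.tgt b.2.tgt :=
  Expn.src_le h.symInv

/-- `IsComp a b c`: the target tree of `b` is the source tree of `a`, and `c` is the
composition of `a` and `b`. -/
inductive IsComp : Sym → Sym → Sym → Prop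
  | mk {n : ℕ} (f₂ f₁ : Symbol n) (h : f₁.tgt = f₂.src) :
      IsComp ⟨n, f₂⟩ ⟨n, f₁⟩ ⟨n, f₂.comp f₁ h⟩

theorem IsComp.exists_of_eq {a b : Sym} (h : b.2.tgt = a.2.src) : ∃ c, IsComp a b c := by
  obtain ⟨n, f⟩ := a
  obtain ⟨m, f'⟩ := b
  simp only at h
  obtain rfl : n = m := by rw [← f.num_src, ← f'.num_tgt, h]
  exact ⟨_, IsComp.mk f f' h⟩

theorem IsComp.eq {a b c c' : Sym} (h : IsComp a b c) (h' : IsComp a b c') : c = c' := by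
  cases h; cases h'; rfl

theorem IsComp.tgt_eq {a b c : Sym} (h : IsComp a b c) : b.2.tgt = a.2.src := by
  cases h with | mk f f' h => exact h

theorem IsComp.src_eq {a b c : Sym} (h : IsComp a b c) : c.2.src = b.2.src := by
  cases h; rfl

theorem IsComp.tgt_eq' {a b c : Sym} (h : IsComp a b c) : c.2.tgt = a.2.tgt := by
  cases h; rfl

theorem IsComp.g_eq {a b c : Sym} (h : IsComp a b c) : c.2.g = a.2.g * b.2.g := by
  cases h; rfl

theorem IsComp.assoc {a b c ab bc x y : Sym} (h1 : IsComp a b ab) (h2 : IsComp b c bc)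
    (h3 : IsComp ab c x) (h4 : IsComp a bc y) : x = y := by
  cases h1; cases h2; cases h3; cases h4
  congr 1
  exact Symbol.ext (mul_assoc _ _ _) rfl rfl (mul_assoc _ _ _)

theorem IsComp.step {a b c b' : Sym} (h : IsComp a b c) (hb : Step b b') :
    ∃ a' c', Step a a' ∧ Step c c' ∧ IsComp a' b' c' := by
  cases h with
  | mk f₂ f₁ h =>
    cases hb with
    | mk _ i hi =>
      obtain ⟨h', e⟩ := Symbol.comp_expand f₂ f₁ h hi
      refine ⟨_, _, Step.mk f₂ (toPerm _ f₁.σ i) ((toPerm_lt _ _).2 hi), Step.mk _ i hi, ?_⟩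
      rw [e]
      exact IsComp.mk _ _ _

theorem IsComp.expn {a b c b' : Sym} (h : IsComp a b c) (hb : Expn b b') :
    ∃ a' c', Expn a a' ∧ Expn c c' ∧ IsComp a' b' c' := by
  induction hb with
  | refl => exact ⟨a, c, .refl, .refl, h⟩
  | tail _ hs ih =>
    obtain ⟨a', c', h1, h2, h3⟩ := ih
    obtain ⟨a'', c'', h4, h5, h6⟩ := h3.step hs
    exact ⟨a'', c'', h1.tail h4, h2.tail h5, h6⟩

/-- Two symbols are equivalent if they have a common expansion. -/
def symSetoid : Setoid Sym where
  r a b := ∃ c, Expn a c ∧ Expn b c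
  iseqv := by
    refine ⟨fun a => ⟨a, .refl, .refl⟩, fun ⟨c, h1, h2⟩ => ⟨c, h2, h1⟩, ?_⟩
    rintro a b c ⟨d, had, hbd⟩ ⟨e, hbe, hce⟩
    obtain ⟨d', h1, h2⟩ := Expn.exists_src d (d.2.src.sup e.2.src) (DTree.le_sup_left _ _)
    obtain ⟨e', h3, h4⟩ := Expn.exists_src e (d.2.src.sup e.2.src) (DTree.le_sup_right _ _)
    have := Expn.unique (hbd.trans h1) (hbe.trans h3) (h2.trans h4.symm)
    subst this
    exact ⟨d', had.trans h1, hce.trans h3⟩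

/-- The quasi-braid extension `Ã_N` of Neretin's group: symbols modulo expansion. -/
def Atilde : Type := Quotient symSetoid

/-- The element of `Ã_N` defined by a symbol. -/
def cls (a : Sym) : Atilde := Quotient.mk symSetoid a

theorem cls_eq {a b : Sym} : cls a = cls b ↔ ∃ c, Expn a c ∧ Expn b c :=
  ⟨fun h => Quotient.exact (s := symSetoid) h, fun h => Quotient.sound (s := symSetoid) h⟩

theorem cls_eq_of_expn {a b : Sym} (h : Expn a b) : cls a = cls b := cls_eq.2 ⟨b, h, .refl⟩

theorem cls_surj (x : Atilde) : ∃ a, cls a = x := Quotient.exists_rep (s := symSetoid) x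

theorem exists_mul (x y : Atilde) :
    ∃ z a b c, IsComp a b c ∧ cls a = x ∧ cls b = y ∧ cls c = z := by
  obtain ⟨a, rfl⟩ := cls_surj x
  obtain ⟨b, rfl⟩ := cls_surj y
  obtain ⟨b', hb, hb'⟩ := Expn.exists_tgt b (b.2.tgt.sup a.2.src) (DTree.le_sup_left _ _)
  obtain ⟨a', ha, ha'⟩ := Expn.exists_src a (b.2.tgt.sup a.2.src) (DTree.le_sup_right _ _)
  obtain ⟨c, hc⟩ := IsComp.exists_of_eq (hb'.trans ha'.symm)
  exact ⟨_, a', b', c, hc, (cls_eq_of_expn ha).symm, (cls_eq_of_expn hb).symm, rfl⟩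

theorem mul_unique {a b c a' b' c' : Sym} (h : IsComp a b c) (h' : IsComp a' b' c')
    (ha : cls a = cls a') (hb : cls b = cls b') : cls c = cls c' := by
  obtain ⟨a₀, ha₀, ha₀'⟩ := cls_eq.1 ha
  obtain ⟨b₀, hb₀, hb₀'⟩ := cls_eq.1 hb
  obtain ⟨B, hB, hB'⟩ := Expn.exists_tgt b₀ (b₀.2.tgt.sup a₀.2.src) (DTree.le_sup_left _ _)
  obtain ⟨A₀, hA, hA'⟩ := Expn.exists_src a₀ (b₀.2.tgt.sup a₀.2.src) (DTree.le_sup_right _ _)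
  obtain ⟨A, C, h1, h2, h3⟩ := h.expn (hb₀.trans hB)
  obtain ⟨A', C', h1', h2', h3'⟩ := h'.expn (hb₀'.trans hB)
  have e1 : A = A₀ := Expn.unique h1 (ha₀.trans hA) (by rw [← h3.tgt_eq, hB', hA'])
  have e2 : A' = A₀ := Expn.unique h1' (ha₀'.trans hA) (by rw [← h3'.tgt_eq, hB', hA'])
  subst e1
  subst e2
  have := h3.eq h3'
  subst this
  exact cls_eq.2 ⟨C, h2, h2'⟩

/-- Multiplication in `Ã_N` is composition of composable symbols. -/
noncomputable instance : Mul Atilde := ⟨fun x y => (exists_mul x y).choose⟩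

theorem cls_mul {a b c : Sym} (h : IsComp a b c) : cls a * cls b = cls c := by
  obtain ⟨a', b', c', h', ha, hb, hc⟩ := (exists_mul (cls a) (cls b)).choose_spec
  exact hc.symm.trans (mul_unique h' h ha hb)

noncomputable instance : One Atilde := ⟨cls ⟨_, Symbol.ident .leaf⟩⟩

theorem eq_ident {m : ℕ} (f : Symbol m) (t : DTree) (h1 : f.g = 1) (h2 : f.src = t)
    (h3 : f.tgt = t) (h4 : f.σ = 1) : (⟨m, f⟩ : Sym) = ⟨t.num, Symbol.ident t⟩ := by
  have hm : m = t.num := by rw [← h2, f.num_src]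
  subst hm
  congr 1
  exact Symbol.ext h1 h2 h3 h4

theorem Expn.ident {t : DTree} {b : Sym} (h : Expn ⟨t.num, Symbol.ident t⟩ b) :
    b = ⟨b.2.src.num, Symbol.ident b.2.src⟩ := by
  induction h with
  | refl => rfl
  | @tail b c _ h ih =>
    generalize b.2.src = s at ih
    subst ih
    cases h with
    | mk _ i hi =>
      have := Symbol.ident_expand s hi
      exact this

theorem cls_ident (t : DTree) : cls ⟨t.num, Symbol.ident t⟩ = 1 := by
  obtain ⟨b, h1, h2⟩ := Expn.exists_src ⟨_, Symbol.ident .leaf⟩ t trivial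
  have := h1.ident
  rw [h2] at this
  rw [← this]
  exact (cls_eq_of_expn h1).symm

noncomputable instance : Inv Atilde :=
  ⟨Quotient.lift (s := symSetoid) (fun a => cls (symInv a)) (by
    rintro a b ⟨c, h1, h2⟩
    exact cls_eq.2 ⟨_, h1.symInv, h2.symInv⟩)⟩

theorem cls_inv (a : Sym) : (cls a)⁻¹ = cls (symInv a) := rfl

theorem IsComp.one_left (a : Sym) : IsComp ⟨a.2.tgt.num, Symbol.ident a.2.tgt⟩ a a := by
  obtain ⟨n, f⟩ := a
  let e : Symbol n := ⟨1, f.tgt, f.tgt, 1, f.num_tgt, f.num_tgt, fun i _ => by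
    rw [map_one]; exact IsTreeIso.one _⟩
  have h := eq_ident e f.tgt rfl rfl rfl rfl
  have h' := IsComp.mk e f rfl
  rw [h] at h'
  convert h' using 2
  exact Symbol.ext (one_mul _).symm rfl rfl (one_mul _).symm

theorem IsComp.one_right (a : Sym) : IsComp a ⟨a.2.src.num, Symbol.ident a.2.src⟩ a := by
  obtain ⟨n, f⟩ := a
  let e : Symbol n := ⟨1, f.src, f.src, 1, f.num_src, f.num_src, fun i _ => by
    rw [map_one]; exact IsTreeIso.one _⟩
  have h := eq_ident e f.src rfl rfl rfl rfl
  have h' := IsComp.mk f e rfl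
  rw [h] at h'
  convert h' using 2
  exact Symbol.ext (mul_one _).symm rfl rfl (mul_one _).symm

theorem IsComp.inv_left (a : Sym) :
    IsComp (symInv a) a ⟨a.2.src.num, Symbol.ident a.2.src⟩ := by
  obtain ⟨n, f⟩ := a
  have h' := IsComp.mk f.inv f rfl
  rw [eq_ident (f.inv.comp f rfl) f.src (inv_mul_cancel _) rfl rfl (inv_mul_cancel _)] at h'
  exact h'

/-- The group structure of `Ã_N`. -/
noncomputable instance : Group Atilde :=
  Group.ofLeftAxioms
    (by
      intro x y z
      obtain ⟨a, rfl⟩ := cls_surj x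
      obtain ⟨b, rfl⟩ := cls_surj y
      obtain ⟨c, rfl⟩ := cls_surj z
      obtain ⟨b', hb, hb'⟩ := Expn.exists_src b (b.2.src.sup c.2.tgt) (DTree.le_sup_left _ _)
      obtain ⟨b'', hb'', h3⟩ := Expn.exists_tgt b' (b'.2.tgt.sup a.2.src) (DTree.le_sup_left _ _)
      obtain ⟨a'', ha'', h4⟩ := Expn.exists_src a (b'.2.tgt.sup a.2.src) (DTree.le_sup_right _ _)
      obtain ⟨c'', hc'', h5⟩ := Expn.exists_tgt c b''.2.src
        (DTree.le_trans (hb' ▸ DTree.le_sup_right _ _) (Expn.src_le hb''))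
      rw [cls_eq_of_expn ha'', cls_eq_of_expn (hb.trans hb''), cls_eq_of_expn hc'']
      obtain ⟨ab, hab⟩ := IsComp.exists_of_eq (h3.trans h4.symm)
      obtain ⟨bc, hbc⟩ := IsComp.exists_of_eq h5
      obtain ⟨u, hu⟩ := IsComp.exists_of_eq (h5.trans hab.src_eq.symm)
      obtain ⟨v, hv⟩ := IsComp.exists_of_eq (hbc.tgt_eq'.trans (h3.trans h4.symm))
      rw [cls_mul hab, cls_mul hbc, cls_mul hu, cls_mul hv, IsComp.assoc hab hbc hu hv])
    (by
      intro x
      obtain ⟨a, rfl⟩ := cls_surj x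
      rw [← cls_ident a.2.tgt]
      exact cls_mul (IsComp.one_left a))
    (by
      intro x
      obtain ⟨a, rfl⟩ := cls_surj x
      rw [cls_inv, cls_mul (IsComp.inv_left a), cls_ident])

/-- The projection `Ã_N → N`. -/
noncomputable def toN : Atilde →* N :=
  MonoidHom.mk' (Quotient.lift (s := symSetoid) (fun a => a.2.g) (by
    rintro a b ⟨c, h1, h2⟩
    exact (Expn.g_eq h1).symm.trans (Expn.g_eq h2))) (by
    intro x y
    obtain ⟨z, a, b, c, h, rfl, rfl, rfl⟩ := exists_mul x y
    rw [cls_mul h]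
    exact h.g_eq)

theorem toN_cls (a : Sym) : toN (cls a) = a.2.g := rfl

/-- Every element of `N` is defined by a symbol. -/
theorem exists_symbol (g : N) : ∃ a : Sym, a.2.g = g := by
  obtain ⟨g, k, hk⟩ := g
  have hk' : ∀ i : ℕ, ∃ v, IsTreeIso g ((DTree.full k).word i) v :=
    fun i => hk _ (DTree.word_full_length k i)
  choose f hf using hk'
  set m := (DTree.full k).num with hm
  -- every infinite sequence has exactly one of the words `f i` as a prefix
  have hex : ∀ x : Stream' Bool, ∃ i < m, x.take (f i).length = f i := by
    intro x
    obtain ⟨i, hi, h⟩ := (DTree.full k).exists_word (g⁻¹ x)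
    refine ⟨i, hi, ?_⟩
    have := ((hf i).1 _).1 h
    rwa [perm_apply_inv] at this
  have huniq : ∀ (x : Stream' Bool) (i j : ℕ), i < m → j < m → x.take (f i).length = f i →
      x.take (f j).length = f j → i = j := by
    intro x i j hi hj h1 h2
    refine (DTree.full k).word_unique (g⁻¹ x) hi hj ?_ ?_
    · rw [(hf i).1, perm_apply_inv]; exact h1
    · rw [(hf j).1, perm_apply_inv]; exact h2
  obtain ⟨K, hK⟩ : ∃ K, ∀ i < m, (f i).length ≤ K := by
    refine ⟨∑ i ∈ Finset.range m, (f i).length, fun i hi => ?_⟩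
    exact Finset.single_le_sum (f := fun i => (f i).length) (fun _ _ => Nat.zero_le _)
      (Finset.mem_range.2 hi)
  set P : List Bool → Prop := fun w => ∃ i < m, w = f i with hP
  set t := DTree.build P K [] with ht
  have hword : ∀ j, ∃ i < m, t.word j = f i := by
    intro j
    have := DTree.build_word P K [] (by
      intro z hz
      obtain ⟨i, hi, h⟩ := hex (z ++ₛ Stream'.const false)
      refine ⟨f i, ?_, i, hi, by simp⟩
      rw [← h]
      conv_rhs => rw [← take_app z (Stream'.const false)]
      rw [Stream'.take_prefix, hz]
      exact hK i hi) j
    simpa using this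
  have hidx : ∀ i : Fin m, ∃ j : Fin t.num, t.word j = f i := by
    intro i
    obtain ⟨j, hj, h⟩ := t.exists_word (f i ++ₛ Stream'.const false)
    obtain ⟨i', hi', h'⟩ := hword j
    rw [h'] at h
    have := huniq _ _ _ i.2 hi' (take_app _ _) h
    exact ⟨⟨j, hj⟩, by rw [h', this]⟩
  choose e he using hidx
  have hbij : Function.Bijective e := by
    constructor
    · intro i j hij
      have h1 := he i
      rw [hij, he j] at h1
      refine Fin.ext (huniq (f i ++ₛ Stream'.const false) _ _ i.2 j.2 (take_app _ _) ?_)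
      rw [h1]; exact take_app _ _
    · intro j
      obtain ⟨i, hi, h⟩ := hword j
      refine ⟨⟨i, hi⟩, Fin.ext (t.word_unique (f i ++ₛ Stream'.const false) (e _).2 j.2 ?_ ?_)⟩
      · rw [he]; exact take_app _ _
      · rw [h]; exact take_app _ _
  have hn : m = t.num := by simpa using Fintype.card_of_bijective hbij
  obtain ⟨σ, hσ⟩ := toPerm_surj ((Equiv.ofBijective e hbij).trans (finCongr hn.symm))
  refine ⟨⟨m, ⟨g, k, hk⟩, DTree.full k, t, σ, rfl, hn.symm, fun i hi => ?_⟩, rfl⟩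
  have h1 := hσ ⟨i, hi⟩
  simp only [Equiv.trans_apply, Equiv.ofBijective_apply, finCongr_apply, Fin.val_cast] at h1
  rw [h1, he ⟨i, hi⟩]
  exact hf i

theorem toN_surjective : Function.Surjective toN := fun g => by
  obtain ⟨a, ha⟩ := exists_symbol g
  exact ⟨cls a, ha⟩
/-! ### Stable lengths -/

/-- `PJ_{2^∞}`, the kernel of the projection `Ã_N → N`; it consists of the classes of the pure
quasi-braids in the groups `PJ_{2^k}`, see `mem_PJinf`. -/
noncomputable def PJinf : Subgroup Atilde := toN.ker

/-- The length modulo two of the quasi-braid of a symbol. -/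
def lenSym (a : Sym) : ZMod 2 := (len a.1 a.2.σ).toAdd

theorem lenSym_comp {a b c : Sym} (h : IsComp a b c) : lenSym c = lenSym a + lenSym b := by
  cases h with
  | mk f f' h => simp [lenSym, Symbol.comp]

theorem lenSym_inv (a : Sym) : lenSym (symInv a) = lenSym a := by
  change (len a.1 a.2.σ⁻¹).toAdd = _
  rw [map_inv, toAdd_inv, CharTwo.neg_eq]; rfl

theorem src_eq_tgt {a : Sym} (h : a.2.g = 1) : a.2.src = a.2.tgt := by
  obtain ⟨n, f⟩ := a
  simp only at h
  refine DTree.eq_of_words fun i hi => ?_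
  have hi' : i < n := by rw [← f.num_src]; exact hi
  refine ⟨toPerm n f.σ i, by rw [f.num_tgt]; exact (toPerm_lt _ _).2 hi', ?_⟩
  have := f.iso i hi'
  rw [h] at this
  exact (IsTreeIso.one _).prefix_unique this

theorem Symbol.word_eq {n : ℕ} (f : Symbol n) (h : f.g = 1) {i : ℕ} (hi : i < n) :
    f.tgt.word (toPerm n f.σ i) = f.src.word i := by
  have := f.iso i hi
  rw [h] at this
  exact this.prefix_unique (IsTreeIso.one _)

theorem toPerm_ge {n : ℕ} (σ : J n) {i : ℕ} (hi : n ≤ i) : toPerm n σ i = i := by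
  induction σ using J_induction with
  | h1 => simp
  | hm a b h1 h2 y ih =>
    rw [map_mul, Equiv.Perm.mul_apply, ih, toPerm_al h1 h2, rev_apply, if_neg (by omega)]

theorem pure_of_g_eq_one {a : Sym} (h : a.2.g = 1) : a.2.σ ∈ PJ a.1 := by
  have hst := src_eq_tgt h
  obtain ⟨n, f⟩ := a
  simp only at h hst ⊢
  rw [PJ, MonoidHom.mem_ker]
  ext i
  rw [Equiv.Perm.one_apply]
  rcases lt_or_ge i n with hi | hi
  · have h1 := f.word_eq h hi
    rw [← hst] at h1
    refine f.src.word_unique (f.src.word i ++ₛ Stream'.const false)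
      (by rw [f.num_src]; exact (toPerm_lt _ _).2 hi) (by rw [f.num_src]; exact hi) ?_
      (take_app _ _)
    rw [h1]; exact take_app _ _
  · exact toPerm_ge _ hi

/-- The symbol `(T_{2^k}, T_{2^k}, p)` for a pure quasi-braid `p ∈ PJ_{2^k}`. -/
def pureSym (k : ℕ) (p : PJ (2 ^ k)) : Sym :=
  ⟨2 ^ k, 1, DTree.full k, DTree.full k, p.1, DTree.num_full k, DTree.num_full k, by
    intro i _
    have : toPerm (2 ^ k) p.1 = 1 := p.2
    rw [this]
    exact IsTreeIso.one _⟩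

theorem mem_PJinf (x : Atilde) : x ∈ PJinf ↔ ∃ (k : ℕ) (p : PJ (2 ^ k)), x = cls (pureSym k p) := by
  constructor
  · intro h
    obtain ⟨a, rfl⟩ := cls_surj x
    obtain ⟨K, hK⟩ := a.2.src.le_full
    obtain ⟨b, h1, h2⟩ := Expn.exists_src a (DTree.full K) (hK K le_rfl)
    have hg : b.2.g = 1 := (Expn.g_eq h1).trans h
    have hp := pure_of_g_eq_one hg
    have ht := src_eq_tgt hg
    rw [cls_eq_of_expn h1]
    obtain ⟨n, f⟩ := b
    simp only at h2 hg hp ht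
    obtain rfl : n = 2 ^ K := by rw [← f.num_src, h2, DTree.num_full]
    refine ⟨K, ⟨f.σ, hp⟩, congrArg cls ?_⟩
    unfold pureSym
    congr 1
    exact Symbol.ext hg h2 (ht.symm.trans h2) rfl
  · rintro ⟨k, p, rfl⟩
    rfl

theorem lenSym_step {a b : Sym} (h : Step a b) (hg : a.2.g = 1) : lenSym b = lenSym a := by
  cases h with
  | mk f i hi =>
    have : f.eps i = false := by
      unfold Symbol.eps
      simp only at hg
      rw [f.word_eq hg hi, hg]
      exact IsTreeIso.swaps_one _
    change (len _ (expand i f.σ * Symbol.tauPow _ i _)).toAdd = (len _ f.σ).toAdd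
    rw [this, map_mul, len_expand]
    simp [Symbol.tauPow]

theorem lenSym_expn {a b : Sym} (h : Expn a b) (hg : a.2.g = 1) : lenSym b = lenSym a := by
  induction h with
  | refl => rfl
  | tail h1 h2 ih => rw [lenSym_step h2 ((Expn.g_eq h1).trans hg), ih]

/-- The stable length of the elements of `PJ_{2^∞}` (extended by `0` to `Ã_N`). -/
noncomputable def ellFun : Atilde → ZMod 2 := open Classical in
  Quotient.lift (s := symSetoid) (fun a => if a.2.g = 1 then lenSym a else 0) (by
    rintro a b ⟨c, h1, h2⟩
    rw [← Expn.g_eq h1, ← Expn.g_eq h2]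
    split_ifs with h
    · rw [← lenSym_expn h1 ((Expn.g_eq h1).symm.trans h),
        ← lenSym_expn h2 ((Expn.g_eq h2).symm.trans h)]
    · rfl)

theorem ellFun_cls {a : Sym} (h : a.2.g = 1) : ellFun (cls a) = lenSym a := if_pos h

/-- The stable length homomorphism `ℓ_∞ : PJ_{2^∞} → ℤ/2ℤ`. -/
noncomputable def ellInf : PJinf →* Multiplicative (ZMod 2) :=
  MonoidHom.mk' (fun x => Multiplicative.ofAdd (ellFun x.1)) (by
    rintro ⟨x, hx⟩ ⟨y, hy⟩
    obtain ⟨z, a, b, c, h, rfl, rfl, rfl⟩ := exists_mul x y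
    change Multiplicative.ofAdd (ellFun (cls a * cls b)) = _
    have ha : a.2.g = 1 := hx
    have hb : b.2.g = 1 := hy
    have hc : c.2.g = 1 := by rw [h.g_eq, ha, hb, one_mul]
    rw [cls_mul h, ellFun_cls hc, lenSym_comp h, ofAdd_add, ← ellFun_cls ha, ← ellFun_cls hb])

theorem ellInf_pureSym (k : ℕ) (p : PJ (2 ^ k)) (h : cls (pureSym k p) ∈ PJinf) :
    ellInf ⟨cls (pureSym k p), h⟩ = len (2 ^ k) p :=
  congrArg Multiplicative.ofAdd (ellFun_cls (a := pureSym k p) rfl)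

theorem ellInf_surjective : Function.Surjective ellInf := by
  intro z
  obtain h | h : z = Multiplicative.ofAdd 0 ∨ z = Multiplicative.ofAdd 1 := by
    revert z; decide
  · exact ⟨1, by rw [map_one, h]; rfl⟩
  · subst h
    -- a pure quasi-braid of odd length
    have h01 : (1 : ℕ) < 2 ^ 2 := by norm_num
    have h12 : (2 : ℕ) < 2 ^ 2 := by norm_num
    have hp : al (2 ^ 2) 0 1 * al (2 ^ 2) 1 2 * al (2 ^ 2) 0 1 * al (2 ^ 2) 0 2 ∈ PJ (2 ^ 2) := by
      change toPerm (2 ^ 2) _ = 1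
      simp only [map_mul]
      rw [toPerm_al (by omega) h01, toPerm_al (by omega) h12, toPerm_al (by omega) h12]
      ext i
      simp only [Equiv.Perm.mul_apply, rev_apply, Equiv.Perm.one_apply]
      split_ifs <;> omega
    refine ⟨⟨cls (pureSym 2 ⟨_, hp⟩), (mem_PJinf _).2 ⟨_, _, rfl⟩⟩, ?_⟩
    rw [ellInf_pureSym]
    simp only [map_mul]
    rw [len_al (by omega) h01, len_al (by omega) h12, len_al (by omega) h12]
    decide

/-- The kernel of `ℓ_∞`, as a subgroup of `Ã_N`. -/
noncomputable def KerEll : Subgroup Atilde := ellInf.ker.map PJinf.subtype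

theorem mem_KerEll {x : Atilde} : x ∈ KerEll ↔ x ∈ PJinf ∧ ellFun x = 0 := by
  constructor
  · rintro ⟨y, hy, rfl⟩
    exact ⟨y.2, hy⟩
  · rintro ⟨h1, h2⟩
    exact ⟨⟨x, h1⟩, congrArg Multiplicative.ofAdd h2, rfl⟩

theorem ellFun_conj (x : Atilde) {p : Atilde} (hp : p ∈ PJinf) :
    ellFun (x * p * x⁻¹) = ellFun p := by
  obtain ⟨b, rfl⟩ := cls_surj p
  obtain ⟨a, rfl⟩ := cls_surj x
  obtain ⟨b', hb, hb'⟩ := Expn.exists_src b (b.2.src.sup a.2.src) (DTree.le_sup_left _ _)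
  obtain ⟨a', ha, ha'⟩ := Expn.exists_src a (b.2.src.sup a.2.src) (DTree.le_sup_right _ _)
  have hg : b'.2.g = 1 := (Expn.g_eq hb).trans hp
  have ht := src_eq_tgt hg
  rw [cls_eq_of_expn hb, cls_eq_of_expn ha]
  obtain ⟨c, hc⟩ := IsComp.exists_of_eq (ht.symm.trans (hb'.trans ha'.symm))
  obtain ⟨d, hd⟩ := IsComp.exists_of_eq (a := c) (b := symInv a')
    (ha'.trans (hb'.symm.trans hc.src_eq.symm))
  have hdg : d.2.g = 1 := by
    rw [hd.g_eq, hc.g_eq, hg, mul_one]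
    exact mul_inv_cancel _
  rw [cls_mul hc, cls_inv, cls_mul hd, ellFun_cls hdg, ellFun_cls hg, lenSym_comp hd,
    lenSym_comp hc, lenSym_inv, add_right_comm, CharTwo.add_self_eq_zero, zero_add]

instance : KerEll.Normal where
  conj_mem := by
    intro x hx g
    rw [mem_KerEll] at hx ⊢
    refine ⟨?_, by rw [ellFun_conj g hx.1]; exact hx.2⟩
    have : PJinf.Normal := by unfold PJinf; infer_instance
    exact this.conj_mem x hx.1 g

/-- The group `A_N = Ã_N / Ker ℓ_∞`. -/
abbrev AN : Type := Atilde ⧸ KerEll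

/-- The projection `A_N → N`. -/
noncomputable def projN : AN →* N :=
  QuotientGroup.lift KerEll toN fun _ hx => (mem_KerEll.1 hx).1

/-- The embedding `ℤ/2ℤ ≅ PJ_{2^∞} / Ker ℓ_∞ → A_N`. -/
noncomputable def inclAN : Multiplicative (ZMod 2) →* AN :=
  (QuotientGroup.map ellInf.ker KerEll PJinf.subtype (Subgroup.le_comap_map _ _)).comp
    (QuotientGroup.quotientKerEquivOfSurjective ellInf ellInf_surjective).symm.toMonoidHom

theorem inclAN_ellInf (p : PJinf) : inclAN (ellInf p) = QuotientGroup.mk p.1 := by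
  have : (QuotientGroup.quotientKerEquivOfSurjective ellInf ellInf_surjective).symm (ellInf p)
      = QuotientGroup.mk p := by
    rw [MulEquiv.symm_apply_eq]; rfl
  change QuotientGroup.map ellInf.ker KerEll PJinf.subtype (Subgroup.le_comap_map _ _)
    ((QuotientGroup.quotientKerEquivOfSurjective ellInf ellInf_surjective).symm (ellInf p)) = _
  rw [this]; rfl

/-- The extension `1 → ℤ/2ℤ → A_N → N → 1`. -/
noncomputable def extAN : GroupExtension (Multiplicative (ZMod 2)) AN N where
  inl := inclAN
  rightHom := projN
  inl_injective := by
    rw [injective_iff_map_eq_one]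
    intro z hz
    obtain ⟨p, rfl⟩ := ellInf_surjective z
    rw [inclAN_ellInf, QuotientGroup.eq_one_iff, mem_KerEll] at hz
    exact congrArg Multiplicative.ofAdd hz.2
  range_inl_eq_ker_rightHom := by
    ext x
    constructor
    · rintro ⟨z, rfl⟩
      obtain ⟨p, rfl⟩ := ellInf_surjective z
      rw [inclAN_ellInf]
      exact p.2
    · intro h
      obtain ⟨y, rfl⟩ := QuotientGroup.mk_surjective x
      exact ⟨ellInf ⟨y, h⟩, inclAN_ellInf ⟨y, h⟩⟩
  rightHom_surjective := fun g => by
    obtain ⟨x, hx⟩ := toN_surjective g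
    exact ⟨QuotientGroup.mk x, hx⟩

/-- The extension is central. -/
theorem extAN_central : extAN.inl.range ≤ Subgroup.center AN := by
  rintro _ ⟨z, rfl⟩
  obtain ⟨p, rfl⟩ := ellInf_surjective z
  change inclAN (ellInf p) ∈ _
  rw [inclAN_ellInf, Subgroup.mem_center_iff]
  intro x
  obtain ⟨y, rfl⟩ := QuotientGroup.mk_surjective x
  have hn : PJinf.Normal := by unfold PJinf; infer_instance
  have hc : y * p.1 * y⁻¹ ∈ PJinf := hn.conj_mem _ p.2 y
  have h1 : ellInf ⟨_, hc⟩ = ellInf p := congrArg Multiplicative.ofAdd (ellFun_conj y p.2)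
  have h2 := inclAN_ellInf ⟨_, hc⟩
  rw [h1, inclAN_ellInf] at h2
  conv_rhs => rw [h2]
  simp only [QuotientGroup.mk_mul, QuotientGroup.mk_inv]
  group

/-! ### The cohomology class of a central extension -/

section CentralExtension

variable {A E G : Type} [AddCommGroup A] [Group E] [Group G]

theorem exists_factor (S : GroupExtension (Multiplicative A) E G) (g h : G) :
    ∃ a : A, S.inl (Multiplicative.ofAdd a) * Function.surjInv S.rightHom_surjective (g * h) =
      Function.surjInv S.rightHom_surjective g * Function.surjInv S.rightHom_surjective h := by
  have : Function.surjInv S.rightHom_surjective g * Function.surjInv S.rightHom_surjective h *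
      (Function.surjInv S.rightHom_surjective (g * h))⁻¹ ∈ S.inl.range := by
    rw [S.range_inl_eq_ker_rightHom, MonoidHom.mem_ker]
    simp only [map_mul, map_inv, Function.surjInv_eq]
    group
  obtain ⟨a, ha⟩ := this
  exact ⟨a.toAdd, by rw [ofAdd_toAdd, ha]; group⟩

/-- The factor set `e` of a central extension of `G` by `A`: for a set-theoretic section `s` of the
extension, `s(g) s(h) = e(g, h) s(gh)`. -/
noncomputable def factorSet (S : GroupExtension (Multiplicative A) E G)
    (hS : S.inl.range ≤ Subgroup.center E) :
    groupCohomology.cocycles₂ (Rep.trivial ℤ G A) :=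
  ⟨fun p => (exists_factor S p.1 p.2).choose, by
    rw [groupCohomology.mem_cocycles₂_iff]
    intro g h j
    have e := fun g h => (exists_factor S g h).choose_spec
    set s := Function.surjInv S.rightHom_surjective
    set c : G → G → A := fun g h => (exists_factor S g h).choose
    change c (g * h) j + c g h = c h j + c g (h * j)
    change ∀ g h, S.inl (Multiplicative.ofAdd (c g h)) * s (g * h) = s g * s h at e
    apply Multiplicative.ofAdd.injective
    apply S.inl_injective
    rw [ofAdd_add, ofAdd_add, map_mul, map_mul]
    apply mul_right_cancel (b := s (g * h * j))
    have hcomm := Subgroup.mem_center_iff.1 (hS ⟨Multiplicative.ofAdd (c h j), rfl⟩) (s g)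
    have hcomm' := Subgroup.mem_center_iff.1 (hS ⟨Multiplicative.ofAdd (c g h), rfl⟩)
      (S.inl (Multiplicative.ofAdd (c (g * h) j)))
    rw [hcomm', mul_assoc, e, ← mul_assoc, e, mul_assoc, mul_assoc, mul_assoc g h j, e,
      ← mul_assoc (S.inl _), ← hcomm, mul_assoc, e]⟩

/-- The class in `H²(G, A)` of a central extension of `G` by `A`. -/
noncomputable def centralClass (S : GroupExtension (Multiplicative A) E G)
    (hS : S.inl.range ≤ Subgroup.center E) : groupCohomology.H2 (Rep.trivial ℤ G A) :=
  groupCohomology.H2π (Rep.trivial ℤ G A) (factorSet S hS)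

end CentralExtension

/-- The Euler class `Eu ∈ H²(N, ℤ/2ℤ)`. -/
noncomputable def Eu : groupCohomology.H2 (Rep.trivial ℤ N (ZMod 2)) :=
  centralClass extAN extAN_central

/-! ### The sequence of lengths -/

/-- The ideal of almost zero sequences. -/
def almostZero : Ideal (ℕ → ZMod 2) where
  carrier := {s | (Function.support s).Finite}
  add_mem' h1 h2 := (h1.union h2).subset (Function.support_add _ _)
  zero_mem' := by simp
  smul_mem' c s h := by
    refine Set.Finite.subset h fun k hk => ?_
    simp only [Function.mem_support, smul_eq_mul, Pi.mul_apply] at *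
    exact right_ne_zero_of_mul hk

/-- The ring `(ℤ/2ℤ)^ℕ / (ℤ/2ℤ)^(ℕ)`. -/
abbrev R : Type := (ℕ → ZMod 2) ⧸ almostZero

/-- The natural embedding `j` of `ℤ/2ℤ` into `R`, through constant sequences. -/
def jR : ZMod 2 →+* R := (Ideal.Quotient.mk almostZero).comp (Pi.constRingHom ℕ (ZMod 2))

/-- The sequence of lengths of a symbol: if the symbol has an expansion of the form
`(tgt, T_{2^k}, σ_k)`, with `σ_k ∈ J_{2^k}`, then its `k`-th term is the length of `σ_k`. -/
noncomputable def lenSeq (a : Sym) (k : ℕ) : ZMod 2 := open Classical in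
  if h : ∃ b, Expn a b ∧ b.2.src = DTree.full k then lenSym h.choose else 0

theorem lenSeq_eq {a b : Sym} (h : Expn a b) {k : ℕ} (hb : b.2.src = DTree.full k) :
    lenSeq a k = lenSym b := by
  have hex : ∃ b, Expn a b ∧ b.2.src = DTree.full k := ⟨b, h, hb⟩
  unfold lenSeq
  rw [dif_pos hex, Expn.unique hex.choose_spec.1 h (hex.choose_spec.2.trans hb.symm)]

theorem mk_eq_mk {s s' : ℕ → ZMod 2} (K : ℕ) (h : ∀ k, K ≤ k → s k = s' k) :
    Ideal.Quotient.mk almostZero s = Ideal.Quotient.mk almostZero s' := by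
  rw [Ideal.Quotient.eq]
  refine Set.Finite.subset (Set.finite_lt_nat K) fun k hk => ?_
  by_contra hk'
  simp only [Set.mem_ofPred_eq, not_lt] at hk'
  exact hk (by rw [Pi.sub_apply, h k hk', sub_self])

theorem lenSeq_expn {a b : Sym} (h : Expn a b) :
    Ideal.Quotient.mk almostZero (lenSeq a) = Ideal.Quotient.mk almostZero (lenSeq b) := by
  obtain ⟨K, hK⟩ := b.2.src.le_full
  refine mk_eq_mk K fun k hk => ?_
  obtain ⟨c, h1, h2⟩ := Expn.exists_src b _ (hK k hk)
  rw [lenSeq_eq h1 h2, lenSeq_eq (h.trans h1) h2]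

/-- The map `ℓ̃ : Ã_N → R`. -/
noncomputable def ellTilde : Atilde → R :=
  Quotient.lift (s := symSetoid) (fun a => Ideal.Quotient.mk almostZero (lenSeq a)) (by
    rintro a b ⟨c, h1, h2⟩
    exact (lenSeq_expn h1).trans (lenSeq_expn h2).symm)

theorem ellTilde_mul (x : Atilde) {p : Atilde} (hp : p ∈ PJinf) :
    ellTilde (x * p) = ellTilde x + jR (ellFun p) := by
  obtain ⟨a, rfl⟩ := cls_surj x
  obtain ⟨b, rfl⟩ := cls_surj p
  obtain ⟨K, hK⟩ := (a.2.src.sup b.2.src).le_full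
  have hle := fun k hk => DTree.le_trans (DTree.le_sup_left a.2.src b.2.src) (hK k hk)
  have hle' := fun k hk => DTree.le_trans (DTree.le_sup_right a.2.src b.2.src) (hK k hk)
  obtain ⟨a₀, ha₀, ha₀'⟩ := Expn.exists_src a _ (hle K le_rfl)
  obtain ⟨b₀, hb₀, hb₀'⟩ := Expn.exists_src b _ (hle' K le_rfl)
  have hg : b.2.g = 1 := hp
  have hg₀ : b₀.2.g = 1 := (Expn.g_eq hb₀).trans hg
  obtain ⟨c, hc⟩ := IsComp.exists_of_eq
    ((src_eq_tgt hg₀).symm.trans (hb₀'.trans ha₀'.symm))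
  have hxc : cls a * cls b = cls c := by
    rw [cls_eq_of_expn ha₀, cls_eq_of_expn hb₀, cls_mul hc]
  rw [hxc]
  change Ideal.Quotient.mk almostZero (lenSeq c) = Ideal.Quotient.mk almostZero (lenSeq a) +
    Ideal.Quotient.mk almostZero (Pi.constRingHom ℕ (ZMod 2) (ellFun (cls b)))
  rw [← map_add]
  refine mk_eq_mk K fun k hk => ?_
  have hbk : DTree.le b₀.2.src (DTree.full k) := by
    rw [hb₀']
    clear * - hk
    induction K generalizing k with
    | zero => trivial
    | succ K ih =>
      obtain ⟨k, rfl⟩ : ∃ m, k = m + 1 := ⟨k - 1, by omega⟩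
      exact ⟨ih k (by omega), ih k (by omega)⟩
  obtain ⟨b', h1, h2⟩ := Expn.exists_src b₀ _ hbk
  obtain ⟨a', c', h3, h4, h5⟩ := hc.expn h1
  have hg' : b'.2.g = 1 := (Expn.g_eq h1).trans hg₀
  rw [Pi.add_apply, lenSeq_eq h4 (h5.src_eq.trans h2), lenSym_comp h5,
    lenSeq_eq (ha₀.trans h3) (h5.tgt_eq.symm.trans ((src_eq_tgt hg').symm.trans h2)),
    ellFun_cls hg, ← lenSym_expn (hb₀.trans h1) hg]
  rfl

/-- The map `ℓ : A_N → R` induced by `ℓ̃`. -/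
noncomputable def ell : AN → R :=
  Quotient.lift (s := QuotientGroup.leftRel KerEll) ellTilde (by
    intro x y h
    have h' := QuotientGroup.leftRel_apply.1 h
    rw [mem_KerEll] at h'
    have := ellTilde_mul x h'.1
    rw [h'.2, map_zero, add_zero, mul_inv_cancel_left] at this
    exact this.symm)

/-- The morphism `j_* : H²(N, ℤ/2ℤ) → H²(N, R)` induced by `j`. -/
noncomputable def jStar : groupCohomology.H2 (Rep.trivial ℤ N (ZMod 2)) ⟶
    groupCohomology.H2 (Rep.trivial ℤ N R) :=
  (groupCohomology.functor ℤ N 2).map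
    (Rep.ofHom ⟨jR.toAddMonoidHom.toIntLinearMap, fun _ => rfl⟩)

end NeretinEuler

/-! The theorem is a general fact about central extensions, applied to one property of the length
`ell`. Let `1 → A → E → G → 1` be a central extension, `φ : A →+ B` an additive map, and `l : E → B`
any function, not assumed multiplicative, such that `l (x a) = l x + φ a` for `a` in the kernel.
Call `l (x y) - l x - l y` the defect of `l`.

The defect descends to `G`: if `x` and `y` are changed by kernel elements `a` and `b`, centrality
collects both at the right end of the product, so `l (x y)` changes by `φ a + φ b`, and the last two
terms cancel exactly that. This is `defect_eq`.

The defect is also a cocycle in the right class. Take the section `s` with factor set `e`, so that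
`s g * s h` is `s (g h)` times the kernel element `e (g, h)`. Applying `l` to this relation gives `l
(s g * s h) - l (s g) - l (s h) = φ (e (g, h)) - (l (s h) - l (s (g h)) + l (s g))`, that is, `φ ∘
e` minus the coboundary of the 1-cochain `l ∘ s`. The right-hand side is visibly a 2-cocycle
cohomologous to `φ ∘ e`, and `φ ∘ e` represents the pushforward under `φ` of the class of the
extension. This is `exists_cocycle_defect`. No sign is lost, so characteristic two plays no role in
this part.

It remains to see that `ell` satisfies the hypothesis with `φ = jR`; this is `ell_mul_inl`, which
rests on `ellTilde_mul`. An element of `PJ_{2^∞}` acts trivially on the ends, so its symbols have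
equal source and target trees and none of its tree isomorphisms exchanges two halves. Its simple
expansions therefore involve no extra transposition, and since `len_expand` shows that expanding a
quasi-braid keeps its length, its sequence of lengths is eventually the constant `ℓ_∞`. On
composable symbols with source `T_{2^k}` the quasi-braids multiply and their lengths add, so right
multiplication by a pure element adds the constant sequence `j (ℓ_∞)`. For an arbitrary symbol each
exchange of halves contributes a transposition of length one, so the sequence may vary with `k`.
This is why lengths take values in sequences rather than in `ℤ/2ℤ`; passing to the quotient by
almost zero sequences makes the choice of the first tree `T_{2^k}` irrelevant. -/

namespace NeretinEuler

/-! ### Central extensions: the additivity defect of a function equivariant along the kernel -/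

section CentralExtension

open groupCohomology

variable {A B E G : Type} [AddCommGroup A] [AddCommGroup B] [Group E] [Group G]

/-- Defining property of the factor set of a central extension. -/
theorem inl_factorSet_mul (S : GroupExtension (Multiplicative A) E G)
    (hS : S.inl.range ≤ Subgroup.center E) (g h : G) :
    S.inl (Multiplicative.ofAdd (factorSet S hS (g, h))) *
        Function.surjInv S.rightHom_surjective (g * h) =
      Function.surjInv S.rightHom_surjective g * Function.surjInv S.rightHom_surjective h :=
  (exists_factor S g h).choose_spec

/-- Two elements of an extension with the same projection differ by an element of the kernel. -/
theorem exists_eq_mul_inl (S : GroupExtension (Multiplicative A) E G) {x y : E}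
    (h : S.rightHom x = S.rightHom y) : ∃ a : A, x = y * S.inl (Multiplicative.ofAdd a) := by
  -- The quotient is taken as `y⁻¹ * x`, so that the kernel factor appears on the right of `y`, the
  -- side on which equivariance is assumed below.
  have hxy : y⁻¹ * x ∈ S.inl.range := by
    rw [S.range_inl_eq_ker_rightHom, MonoidHom.mem_ker, map_mul, map_inv, h, inv_mul_cancel]
  obtain ⟨a, ha⟩ := hxy
  exact ⟨a.toAdd, by rw [ofAdd_toAdd, ha, mul_inv_cancel_left]⟩

/-- If `l` is equivariant along the kernel of a central extension, then its defect of additivity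
depends only on the projections of its arguments. -/
theorem defect_eq (S : GroupExtension (Multiplicative A) E G)
    (hS : S.inl.range ≤ Subgroup.center E) (φ : A →+ B) (l : E → B)
    (hl : ∀ x a, l (x * S.inl (Multiplicative.ofAdd a)) = l x + φ a) {x x' y y' : E}
    (hx : S.rightHom x = S.rightHom x') (hy : S.rightHom y = S.rightHom y') :
    l (x * y) - l x - l y = l (x' * y') - l x' - l y' := by
  obtain ⟨a, rfl⟩ := exists_eq_mul_inl S hx
  obtain ⟨b, rfl⟩ := exists_eq_mul_inl S hy
  have hc := Subgroup.mem_center_iff.1 (hS ⟨Multiplicative.ofAdd a, rfl⟩) y'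
  -- Centrality is needed only here: the kernel element `a` moves past `y'`, so both kernel factors
  -- end up at the right of `x' * y'`.
  have hxy : x' * S.inl (Multiplicative.ofAdd a) * (y' * S.inl (Multiplicative.ofAdd b)) =
      x' * y' * S.inl (Multiplicative.ofAdd a) * S.inl (Multiplicative.ofAdd b) := by
    rw [mul_assoc x', ← mul_assoc _ y', ← hc]
    simp only [mul_assoc]
  -- Equivariance is used twice on the product, removing `b` and then `a`, and once on each factor.
  -- The resulting terms `φ a + φ b`, `φ a` and `φ b` cancel.
  rw [hxy, hl, hl, hl, hl]
  abel

/-- The change of coefficients of the trivial representation induced by an additive map. -/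
noncomputable def trivialMap (φ : A →+ B) : Rep.trivial ℤ G A ⟶ Rep.trivial ℤ G B :=
  -- Both actions are trivial, so compatibility with them holds definitionally. For `φ =
  -- jR.toAddMonoidHom` this is the very morphism used in `jStar`, which lets the general result
  -- apply there without any transport.
  Rep.ofHom ⟨φ.toIntLinearMap, fun _ => rfl⟩

/-- An additive map sends the class of a 2-cocycle to the class of its composite with the map. -/
theorem functor_map_H2π (φ : A →+ B) (x : cocycles₂ (Rep.trivial ℤ G A)) :
    (groupCohomology.functor ℤ G 2).map (trivialMap φ) (H2π (Rep.trivial ℤ G A) x) =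
      H2π (Rep.trivial ℤ G B) (mapCocycles₂ (MonoidHom.id G) (trivialMap φ) x) :=
  -- On morphisms the cohomology functor is the map induced by the identity of `G` together with the
  -- coefficient map. The claim is therefore naturality of the projection from cocycles to classes,
  -- for this pair.
  H2π_comp_map_apply (A := Rep.trivial ℤ G A) (B := Rep.trivial ℤ G B) (MonoidHom.id G)
    (trivialMap φ) x

/-- The pushforward of the class of a central extension under `φ` is the class of the defect of
additivity of any map which is `φ`-equivariant along the kernel. -/
theorem exists_cocycle_defect (S : GroupExtension (Multiplicative A) E G)
    (hS : S.inl.range ≤ Subgroup.center E) (φ : A →+ B) (l : E → B)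
    (hl : ∀ x a, l (x * S.inl (Multiplicative.ofAdd a)) = l x + φ a) :
    ∃ c : cocycles₂ (Rep.trivial ℤ G B),
      (∀ x y, c (S.rightHom x, S.rightHom y) = l (x * y) - l x - l y) ∧
      (groupCohomology.functor ℤ G 2).map (trivialMap φ) (centralClass S hS) =
        H2π (Rep.trivial ℤ G B) c := by
  -- This must be the section from which `factorSet` is built: `l ∘ s` is the cochain whose
  -- coboundary corrects `φ ∘ e`.
  set s := Function.surjInv S.rightHom_surjective
  have hs : ∀ g, S.rightHom (s g) = g := Function.surjInv_eq S.rightHom_surjective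
  let e : cocycles₂ (Rep.trivial ℤ G B) :=
    mapCocycles₂ (MonoidHom.id G) (trivialMap φ) (factorSet S hS)
  -- The coboundary of `l ∘ s`. Since the action is trivial, its value at `(g, h)` has the plain
  -- term `l (s h)`, with no action of `g`, and `hd` holds by `rfl`.
  let d : cocycles₂ (Rep.trivial ℤ G B) :=
    ⟨d₁₂ (Rep.trivial ℤ G B) (l ∘ s), d₁₂_apply_mem_cocycles₂ _⟩
  have hd : ∀ g h, d (g, h) = l (s h) - l (s (g * h)) + l (s g) := fun g h => rfl
  have he : ∀ g h, e (g, h) = φ (factorSet S hS (g, h)) := fun g h => rfl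
  -- The witness is read off from `l (s g * s h) = l (s (g * h)) + φ (e (g, h))` after subtracting
  -- `l (s g)` and `l (s h)`. As a difference of two cocycles it needs no separate verification of
  -- the cocycle identity.
  refine ⟨e - d, fun x y => ?_, ?_⟩
  -- The arbitrary lifts `x` and `y` are replaced by the values of `s` at their projections. The
  -- product of these two values is then rewritten through the factor set, and centrality moves the
  -- kernel factor from the left to the right, where `hl` applies.
  · rw [defect_eq S hS φ l hl (hs (S.rightHom x)).symm (hs (S.rightHom y)).symm,
      ← inl_factorSet_mul S hS,
      ← Subgroup.mem_center_iff.1 (hS ⟨Multiplicative.ofAdd _, rfl⟩), hl]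
    change e (S.rightHom x, S.rightHom y) - d (S.rightHom x, S.rightHom y) = _
    rw [hd, he]
    -- The lemma on the factor set introduced the section in unfolded form; it is folded back to
    -- `s`, so that `abel` recognizes equal terms on the two sides.
    change _ = l (s _) + _ - l (s _) - l (s _)
    abel
  · rw [map_sub]
    -- Only `e` contributes to the class of `e - d`, and `e` is the factor set pushed forward along
    -- `φ`.
    have hd0 : H2π (Rep.trivial ℤ G B) d = 0 := (H2π_eq_zero_iff d).2 ⟨l ∘ s, rfl⟩
    rw [hd0, sub_zero]
    exact functor_map_H2π φ _

end CentralExtension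

/-! ### The length on `A_N` and the Euler class -/

/-- The map `ℓ` is `j`-equivariant along the kernel of `A_N → N`. -/
theorem ell_mul_inl (x : AN) (a : ZMod 2) :
    ell (x * extAN.inl (Multiplicative.ofAdd a)) = ell x + jR a := by
  -- The embedding of `ℤ/2ℤ` into `A_N` is defined through the quotient `PJ_{2^∞} / Ker ℓ_∞`, so it
  -- is computed on a pure element `p` with `ℓ_∞ (p) = a`: by `inclAN_ellInf`, the image of `a` is
  -- the class of `p`.
  obtain ⟨p, hp⟩ := ellInf_surjective (Multiplicative.ofAdd a)
  obtain ⟨y, rfl⟩ := QuotientGroup.mk_surjective x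
  have ha : ellFun p.1 = a := congrArg Multiplicative.toAdd hp
  change ell (_ * inclAN (Multiplicative.ofAdd a)) = _
  rw [← hp, inclAN_ellInf, ← ha]
  -- On representatives, `ell` of the product of the classes of `y` and `p` is by definition
  -- `ellTilde (y * p)`.
  exact ellTilde_mul y p.2

end NeretinEuler

/-- Quantifying over all lifts `f'` and `g'` inside the condition on `c` makes independence of the
lifts part of the assertion, and membership in `cocycles₂` is the cocycle identity. Uniqueness shows
that the class equation concerns the cocycle given by the formula and no other: every pair in `N ×
N` has lifts, so the formula alone determines `c`. -/
theorem theorem4 :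
    ∃! c : groupCohomology.cocycles₂ (Rep.trivial ℤ NeretinEuler.N NeretinEuler.R),
      (∀ (f g : NeretinEuler.N) (f' g' : NeretinEuler.AN),
        NeretinEuler.projN f' = f → NeretinEuler.projN g' = g →
          c (f, g) = NeretinEuler.ell (f' * g') - NeretinEuler.ell f' - NeretinEuler.ell g') ∧
      NeretinEuler.jStar NeretinEuler.Eu
        = groupCohomology.H2π (Rep.trivial ℤ NeretinEuler.N NeretinEuler.R) c := by
  obtain ⟨c, hc, hcl⟩ := NeretinEuler.exists_cocycle_defect NeretinEuler.extAN
    NeretinEuler.extAN_central NeretinEuler.jR.toAddMonoidHom NeretinEuler.ell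
    NeretinEuler.ell_mul_inl
  -- Unfolding `jStar` and `Eu` turns the required class equation into `hcl`, the general one for
  -- `extAN` and `jR`.
  refine ⟨c, ⟨?_, hcl⟩, ?_⟩
  · rintro _ _ f' g' rfl rfl
    exact hc f' g'
  -- The class condition is discarded: two cocycles satisfying the formula agree at every pair, as
  -- one sees by choosing lifts through the surjection `A_N → N`.
  · rintro c' ⟨hc', -⟩
    refine groupCohomology.cocycles₂_ext fun f g => ?_
    obtain ⟨f', rfl⟩ := NeretinEuler.extAN.rightHom_surjective f
    obtain ⟨g', rfl⟩ := NeretinEuler.extAN.rightHom_surjective g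
    exact (hc' _ _ f' g' rfl rfl).trans (hc f' g').symm
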